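/- Let $p\ge 5$ be odd, $q\ge 2$ and $d\ge 2$ (for $q\ge 3$ the complex below is the Bourdon building $I_{p,q}$; for $q=2$ it is the tiling of the hyperbolic plane by right-angled $p$-gons). Let $\Gamma=\Gamma_{p,q}=\langle s_i\ (i\in\mathbb Z/p)\mid s_i^q=1,\ [s_i,s_{i+1}]=1\rangle$. The chambers of $I_{p,q}$ are identified with the elements of $\Gamma$, and distinct chambers $g,h$ share an edge iff $g\langle s_i\rangle=h\langle s_i\rangle$ for some $i$. Fix a central chamber $o$; write $B_\Lambda$ for the set of chambers at distance at most $\Lambda$ from $o$ in the graph of chambers sharing an edge ($\Lambda=0,1,2,\dots$), and call $B_{\Lambda+1}\setminus B_\Lambda$ layer $\Lambda+1$. At each chamber $g$ put a perfect tensor $T_g$ with one leg for each chamber sharing an edge with $g$ and $q-1$ dangling bulk legs, all legs being qudits $\mathbb C^d$. (A tensor is perfect if for each bipartition $A\sqcup A^c$ of its legs with $|A|\le|A^c|$ it is, as a map from the legs in $A$ to those in $A^c$, a positive multiple of an isometry.) Contract the two legs joining each pair of chambers that share an edge, and truncate to the chambers in $B_\Lambda$. Let $\mathcal H^\Lambda_{code}$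 be the tensor product of the qudits of all dangling bulk legs of chambers in $B_\Lambda$, let $\mathcal H^\Lambda_{phys}$ be the tensor product of the qudits of all legs from a chamber in $B_\Lambda$ to a chamber outside $B_\Lambda$, and let $N^\Lambda:\mathcal H^\Lambda_{code}\to\mathcal H^\Lambda_{phys}$ be the linear map given by the contracted network. Fix a unit vector $|\mathrm{ref}\rangle\in\mathbb C^d$. Let $M^\Lambda:\mathcal H^\Lambda_{phys}\to\mathcal H^{\Lambda+1}_{phys}$ be the linear map given by contracting with the tensors of layer $\Lambda+1$, all of whose dangling bulk legs are put in the state $|\mathrm{ref}\rangle$. Then for every $\Lambda$: 1. The map $j^\Lambda_{code}:\mathcal H^\Lambda_{code}\to\mathcal H^{\Lambda+1}_{code}$ that tensors a state with $|\mathrm{ref}\rangle$ on each bulk leg of layer $\Lambda+1$ is a linear isometry (in particular injective). There are positive constants $a_\Lambda,b_\Lambda$ such that $u^\Lambda=a_\Lambda N^\Lambda:\mathcal H^\Lambda_{code}\to\mathcal H^\Lambda_{phys}$ and $j^\Lambda_{phys}=b_\Lambda M^\Lambda:\mathcal H^\Lambda_{phys}\to\mathcal H^{\Lambda+1}_{phys}$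 are linear isometries. 2. $u^{\Lambda+1}\circ j^\Lambda_{code}=j^\Lambda_{phys}\circ u^\Lambda$. Moreover, the completed direct limits $\mathcal H_{code}=\varinjlim_\Lambda\mathcal H^\Lambda_{code}$ along $j_{code}$ and $\mathcal H_{phys}=\varinjlim_\Lambda\mathcal H^\Lambda_{phys}$ along $j_{phys}$ are infinite-dimensional Hilbert spaces. They have the universal property of a direct limit: each compatible family of linear maps from the stages to a Hilbert space, with norms bounded by a common $C\geq 0$, factors through a unique bounded linear map on the limit, whose norm is at most $C$. There is a unique linear isometry $u:\mathcal H_{code}\to\mathcal H_{phys}$ with $u\circ\iota^\Lambda_{code}=\iota^\Lambda_{phys}\circ u^\Lambda$ for all $\Lambda$, where $\iota^\Lambda_{code},\iota^\Lambda_{phys}$ are the canonical embeddings of the stages. -/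

import Mathlib

/-! ## Direct limits of sequences of Hilbert spaces -/

section HilbertLimit

universe u v

variable {E : ℕ → Type u} [∀ n, NormedAddCommGroup (E n)] [∀ n, InnerProductSpace ℂ (E n)]

/-- The composite `E m → E (m+1) → ⋯ → E n` of the maps of a sequence of isometries. -/
def isomTrans (f : ∀ n, E n →ₗᵢ[ℂ] E (n + 1)) (m n : ℕ) (h : m ≤ n) : E m →ₗᵢ[ℂ] E n :=
  Nat.leRecOn (C := fun k => E m →ₗᵢ[ℂ] E k) h (fun {k} g => (f k).comp g) LinearIsometry.id

theorem isomTrans_self (f : ∀ n, E n →ₗᵢ[ℂ] E (n + 1)) (m : ℕ) (x : E m) :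
    isomTrans f m m le_rfl x = x := by
  unfold isomTrans
  rw [Nat.leRecOn_self]
  rfl

theorem isomTrans_succ (f : ∀ n, E n →ₗᵢ[ℂ] E (n + 1)) (m n : ℕ) (h : m ≤ n) (x : E m) :
    isomTrans f m (n + 1) (h.trans n.le_succ) x = f n (isomTrans f m n h x) := by
  unfold isomTrans
  rw [Nat.leRecOn_succ h]
  rfl

instance isomTrans_directedSystem (f : ∀ n, E n →ₗᵢ[ℂ] E (n + 1)) :
    DirectedSystem E (fun m n h => ⇑(isomTrans f m n h)) where
  map_self m x := isomTrans_self f m x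
  map_map k j i hij hjk x := by
    induction hjk with
    | refl => exact isomTrans_self f _ _
    | step h ih =>
      rw [isomTrans_succ f _ _ h, isomTrans_succ f _ _ (hij.trans h), ih]

/-- The algebraic direct limit (increasing union) of a sequence of isometries. -/
abbrev AlgLimit (f : ∀ n, E n →ₗᵢ[ℂ] E (n + 1)) : Type u :=
  DirectLimit E (isomTrans f)

/-- The inner product of the algebraic direct limit: two vectors are moved to a common stage,
and their inner product is taken there. -/
noncomputable instance algLimitInner (f : ∀ n, E n →ₗᵢ[ℂ] E (n + 1)) : Inner ℂ (AlgLimit f) where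
  inner := DirectLimit.lift₂ (isomTrans f) (isomTrans f) (fun _ x y => inner ℂ x y)
    (fun i j h x y => ((isomTrans f i j h).inner_map_map x y).symm)

theorem algLimit_inner_def (f : ∀ n, E n →ₗᵢ[ℂ] E (n + 1)) (n : ℕ) (x y : E n) :
    inner ℂ (⟦⟨n, x⟩⟧ : AlgLimit f) ⟦⟨n, y⟩⟧ = inner ℂ x y :=
  DirectLimit.lift₂_def _ _ _ _ _ _ _

@[reducible]
noncomputable def algLimitCore (f : ∀ n, E n →ₗᵢ[ℂ] E (n + 1)) :
    InnerProductSpace.Core ℂ (AlgLimit f) where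
  inner := inner ℂ
  conj_inner_symm := DirectLimit.induction₂ _ fun n x y => by
    rw [algLimit_inner_def, algLimit_inner_def, inner_conj_symm]
  re_inner_nonneg := DirectLimit.induction _ fun n x => by
    rw [algLimit_inner_def]
    exact inner_self_nonneg
  add_left := DirectLimit.induction₃ _ fun n x y z => by
    rw [DirectLimit.add_def, algLimit_inner_def, algLimit_inner_def, algLimit_inner_def,
      inner_add_left]
  smul_left := DirectLimit.induction₂ _ fun n x y r => by
    rw [DirectLimit.smul_def, algLimit_inner_def, algLimit_inner_def, inner_smul_left]
  definite := DirectLimit.induction _ fun n x h => by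
    rw [algLimit_inner_def, inner_self_eq_zero] at h
    rw [h, ← DirectLimit.zero_def]

noncomputable instance algLimitNormed (f : ∀ n, E n →ₗᵢ[ℂ] E (n + 1)) :
    NormedAddCommGroup (AlgLimit f) :=
  (algLimitCore f).toNormedAddCommGroup

noncomputable instance algLimitInnerProductSpace (f : ∀ n, E n →ₗᵢ[ℂ] E (n + 1)) :
    InnerProductSpace ℂ (AlgLimit f) :=
  InnerProductSpace.ofCore (algLimitCore f).toCore

/-- The direct limit of a sequence of inner product spaces and linear isometries, in the category
of Hilbert spaces: the completion of the algebraic direct limit. -/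
abbrev HilbertLimit (f : ∀ n, E n →ₗᵢ[ℂ] E (n + 1)) : Type u :=
  UniformSpace.Completion (AlgLimit f)

/-- The inclusion of a stage into the algebraic direct limit. -/
noncomputable def algLimitOf (f : ∀ n, E n →ₗᵢ[ℂ] E (n + 1)) (n : ℕ) :
    E n →ₗᵢ[ℂ] AlgLimit f :=
  LinearMap.isometryOfInner
    { toFun := fun x => ⟦⟨n, x⟩⟧
      map_add' := fun x y => (DirectLimit.add_def n x y).symm
      map_smul' := fun r x => (DirectLimit.smul_def n x r).symm }
    (algLimit_inner_def f n)

/-- The canonical isometric embedding of a stage into the Hilbert space direct limit. -/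
noncomputable def hilbertLimitOf (f : ∀ n, E n →ₗᵢ[ℂ] E (n + 1)) (n : ℕ) :
    E n →ₗᵢ[ℂ] HilbertLimit f :=
  UniformSpace.Completion.toComplₗᵢ.comp (algLimitOf f n)

/-- `H` with the maps `ι n` is a direct limit of the sequence `f` in the category of Hilbert
spaces: the `ι n` are compatible with `f`, and every compatible, uniformly bounded family of maps
to a Hilbert space `K` factors uniquely through `H`, with the same bound. -/
def IsHilbertDirectLimit (f : ∀ n, E n →ₗᵢ[ℂ] E (n + 1))
    {H : Type u} [NormedAddCommGroup H] [InnerProductSpace ℂ H]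
    (ι : ∀ n, E n →ₗᵢ[ℂ] H) : Prop :=
  (∀ n x, ι (n + 1) (f n x) = ι n x) ∧
  ∀ (K : Type v) [NormedAddCommGroup K] [InnerProductSpace ℂ K] [CompleteSpace K]
    (C : ℝ) (g : ∀ n, E n →L[ℂ] K), 0 ≤ C → (∀ n, ‖g n‖ ≤ C) →
    (∀ n x, g (n + 1) (f n x) = g n x) →
    ∃ G : H →L[ℂ] K, ‖G‖ ≤ C ∧ (∀ n x, G (ι n x) = g n x) ∧
      ∀ G' : H →L[ℂ] K, (∀ n x, G' (ι n x) = g n x) → G' = G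

end HilbertLimit

/-! ## The Bourdon building -/

/-- The relations `s_i ^ q = 1` and `[s_i, s_{i+1}] = 1`, with `i` modulo `p`. -/
def bourdonRels (p q : ℕ) : Set (FreeGroup (ZMod p)) :=
  {r | ∃ i : ZMod p, r = FreeGroup.of i ^ q ∨ 
    r = FreeGroup.of i * FreeGroup.of (i + 1) * (FreeGroup.of i)⁻¹ * (FreeGroup.of (i + 1))⁻¹}

/-- The group `Γ_{p,q}`. It acts simply transitively on the chambers of the Bourdon building
`I_{p,q}`, and its elements are identified with the chambers. -/
abbrev BourdonGroup (p q : ℕ) : Type := PresentedGroup (bourdonRels p q)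

noncomputable instance (p q : ℕ) : DecidableEq (BourdonGroup p q) := Classical.decEq _

/-- The generator `s_i` of `Γ_{p,q}`. -/
def bourdonGen (p q : ℕ) (i : ZMod p) : BourdonGroup p q := PresentedGroup.of i

/-- The edges of `I_{p,q}` of type `i` are the left cosets of the cyclic group `⟨s_i⟩`. -/
abbrev BourdonEdge (p q : ℕ) (i : ZMod p) : Type :=
  BourdonGroup p q ⧸ Subgroup.zpowers (bourdonGen p q i)

/-- The edge of type `i` of the `p`-gon `g`. -/
def edgeOf {p q : ℕ} (i : ZMod p) (g : BourdonGroup p q) : BourdonEdge p q i := g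

/-- The graph of chambers of `I_{p,q}`: two distinct chambers are adjacent when they share an
edge. -/
def chamberGraph (p q : ℕ) : SimpleGraph (BourdonGroup p q) where
  Adj g h := g ≠ h ∧ ∃ i, edgeOf i g = edgeOf i h
  symm := ⟨fun _ _ ⟨hne, i, hi⟩ => ⟨hne.symm, i, hi.symm⟩⟩
  loopless := ⟨fun _ h => h.1 rfl⟩

theorem bourdonGen_pow (p q : ℕ) (i : ZMod p) : bourdonGen p q i ^ q = 1 := by
  have h := PresentedGroup.one_of_mem (rels := bourdonRels p q) (x := FreeGroup.of i ^ q)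
    ⟨i, Or.inl rfl⟩
  simpa [bourdonGen, PresentedGroup.of] using h

theorem chamberGraph_finite_neighbors (p q : ℕ) [NeZero p] [NeZero q] (g : BourdonGroup p q) :
    {h | (chamberGraph p q).Adj g h}.Finite := by
  have hfin : ∀ i, (Subgroup.zpowers (bourdonGen p q i) : Set (BourdonGroup p q)).Finite := by
    intro i
    exact finite_zpowers.mpr
      (isOfFinOrder_iff_pow_eq_one.mpr ⟨q, Nat.pos_of_ne_zero (NeZero.ne q), bourdonGen_pow p q i⟩)
  refine ((Set.finite_iUnion fun i => (hfin i).image (fun x => g * x))).subset ?_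
  rintro h ⟨-, i, hi⟩
  refine Set.mem_iUnion.mpr ⟨i, g⁻¹ * h, QuotientGroup.eq.mp hi, by group⟩

theorem chamberGraph_finite_ball (p q : ℕ) [NeZero p] [NeZero q] (o : BourdonGroup p q) (n : ℕ) :
    {g | (chamberGraph p q).edist o g ≤ n}.Finite := by
  have key : {g | ∃ w : (chamberGraph p q).Walk g o, w.length ≤ n}.Finite := by
    induction n with
    | zero =>
      refine (Set.finite_singleton o).subset ?_
      rintro g ⟨w, hw⟩
      exact SimpleGraph.Walk.eq_of_length_eq_zero (Nat.le_zero.mp hw)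
    | succ n ih =>
      refine ((ih.biUnion fun h _ => chamberGraph_finite_neighbors p q h).union
        (Set.finite_singleton o)).subset ?_
      rintro g ⟨w, hw⟩
      cases w with
      | nil => exact Or.inr rfl
      | cons hadj w' =>
        refine Or.inl (Set.mem_biUnion ⟨w', ?_⟩ hadj.symm)
        simpa using hw
  refine key.subset fun g hg => ?_
  have hg' : (chamberGraph p q).edist g o ≤ n := by
    rw [SimpleGraph.edist_comm]
    exact hg
  obtain ⟨w, hw⟩ := SimpleGraph.exists_walk_of_edist_ne_top
    (ne_top_of_le_ne_top (ENat.natCast_ne_top n) hg')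
  exact ⟨w, by rw [← hw] at hg'; exact_mod_cast hg'⟩

/-- The chambers at distance at most `n` from the central tile `o`. -/
noncomputable def chamberBall {p q : ℕ} [NeZero p] [NeZero q] (o : BourdonGroup p q) (n : ℕ) :
    Finset (BourdonGroup p q) :=
  (chamberGraph_finite_ball p q o n).toFinset

/-- The chambers of layer `n + 1`, i.e. at distance exactly `n + 1` from the central tile `o`. -/
noncomputable def nextLayer {p q : ℕ} [NeZero p] [NeZero q] (o : BourdonGroup p q) (n : ℕ) :
    Finset (BourdonGroup p q) :=
  chamberBall o (n + 1) \ chamberBall o n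

/-! ## Tensor networks -/

/-- The legs of the tensor at the chamber `g`: one leg for each chamber that shares an edge
with `g`, and `q - 1` dangling legs. -/
abbrev Leg {p q : ℕ} (g : BourdonGroup p q) : Type :=
  {h // (chamberGraph p q).Adj g h} ⊕ Fin (q - 1)

noncomputable instance {p q : ℕ} [NeZero p] [NeZero q] (g : BourdonGroup p q) :
    Fintype {h // (chamberGraph p q).Adj g h} :=
  (chamberGraph_finite_neighbors p q g).fintype

/-- Put together values on the legs in `A` and on the legs outside `A`. -/
def glueLegs {L : Type} [Fintype L] [DecidableEq L] {d : ℕ} (A : Finset L)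
    (a : A → Fin d) (b : ↥(Aᶜ) → Fin d) : L → Fin d :=
  fun l => if h : l ∈ A then a ⟨l, h⟩ else b ⟨l, Finset.mem_compl.mpr h⟩

/-- A tensor `T` with finite set of legs `L` and bond dimension `d`, read as a map from the qudits
of the legs in `A` to the qudits of the other legs. -/
noncomputable def tensorAsMap {L : Type} [Fintype L] [DecidableEq L] {d : ℕ}
    (T : (L → Fin d) → ℂ) (A : Finset L) (v : EuclideanSpace ℂ (A → Fin d)) :
    EuclideanSpace ℂ (↥(Aᶜ) → Fin d) :=
  WithLp.toLp 2 fun b => ∑ a, T (glueLegs A a b) * v a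

/-- A tensor is perfect if for each bipartition of its legs into `A` and `Aᶜ` with
`|A| ≤ |Aᶜ|`, it is proportional to an isometry from `A` to `Aᶜ`. -/
def IsPerfectTensor {L : Type} [Fintype L] [DecidableEq L] {d : ℕ} (T : (L → Fin d) → ℂ) : Prop :=
  ∀ A : Finset L, A.card ≤ (Aᶜ).card → ∃ c : ℝ, 0 < c ∧ ∀ v, ‖tensorAsMap T A v‖ = c * ‖v‖

section Network

variable {p q : ℕ} [NeZero p] [NeZero q] {d : ℕ}

/-- The dangling bulk legs of the part of the network on the chambers in `S`. -/
abbrev BulkLeg (S : Finset (BourdonGroup p q)) : Type := S × Fin (q - 1)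

/-- The contracted legs of the part of the network on `S`: the unordered pairs of chambers in `S`
that share an edge. -/
abbrev InnerLeg (S : Finset (BourdonGroup p q)) : Type :=
  {e : Sym2 (BourdonGroup p q) // e ∈ (chamberGraph p q).edgeSet ∧ ∀ g ∈ e, g ∈ S}

/-- The cut legs of the part of the network on `S`: the legs of chambers `g` in `S` that point to
chambers `h` outside `S`, written as pairs `(g, h)`. -/
abbrev OuterLeg (S : Finset (BourdonGroup p q)) : Type :=
  {e : BourdonGroup p q × BourdonGroup p q //
    e.1 ∈ S ∧ e.2 ∉ S ∧ (chamberGraph p q).Adj e.1 e.2}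

noncomputable instance (S : Finset (BourdonGroup p q)) : Fintype (InnerLeg S) :=
  haveI : Finite (InnerLeg S) := Finite.of_injective
    (fun e => (⟨e.1, Finset.mem_sym2_iff.mpr e.2.2⟩ : S.sym2))
    fun _ _ h => Subtype.ext (Subtype.mk.inj h)
  Fintype.ofFinite _

noncomputable instance (S : Finset (BourdonGroup p q)) : Fintype (OuterLeg S) :=
  haveI : Finite (OuterLeg S) := Finite.of_injective
    (fun e => (⟨⟨e.1.1, e.2.1⟩, ⟨e.1.2, e.2.2.2⟩⟩ :
      Σ g : S, {h // (chamberGraph p q).Adj g.1 h}))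
    fun e e' h => by
      obtain ⟨⟨g, k⟩, _, _, _⟩ := e
      obtain ⟨⟨g', k'⟩, _, _, _⟩ := e'
      simp only [Sigma.mk.injEq, Subtype.mk.injEq] at h
      obtain ⟨rfl, h⟩ := h
      obtain rfl : k = k' := congrArg Subtype.val (eq_of_heq h)
      rfl
  Fintype.ofFinite _

/-- The values on the legs of a chamber `g` of `S`, given values `x` on the bulk legs, `z` on the
contracted legs and `y` on the cut legs. -/
noncomputable def legValues (S : Finset (BourdonGroup p q)) (x : BulkLeg S → Fin d)
    (z : InnerLeg S → Fin d) (y : OuterLeg S → Fin d) (g : S) : Leg g.1 → Fin d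
  | Sum.inl h =>
      if hS : h.1 ∈ S then
        z ⟨s(g.1, h.1), h.2, fun k hk => by
          rcases Sym2.mem_iff.mp hk with rfl | rfl
          exacts [g.2, hS]⟩
      else y ⟨(g.1, h.1), g.2, hS, h.2⟩
  | Sum.inr a => x (g, a)

/-- The component, at the values `x` of the bulk legs and `y` of the cut legs, of the tensor that
results from contracting the tensors at the chambers in `S`. -/
noncomputable def contractedTensor (T : ∀ g : BourdonGroup p q, (Leg g → Fin d) → ℂ)
    (S : Finset (BourdonGroup p q)) (x : BulkLeg S → Fin d) (y : OuterLeg S → Fin d) : ℂ :=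
  ∑ z : InnerLeg S → Fin d, ∏ g : S, T g.1 (legValues S x z y g)

/-- The code space of the network truncated at distance `n`: the tensor product of one qudit
`ℂ^d` for each dangling bulk leg, in coordinates of the product basis. -/
abbrev CodeSpace (d : ℕ) (o : BourdonGroup p q) (n : ℕ) : Type :=
  EuclideanSpace ℂ (BulkLeg (chamberBall o n) → Fin d)

/-- The physical space of the network truncated at distance `n`: the tensor product of one qudit
`ℂ^d` for each boundary leg. -/
abbrev PhysSpace (d : ℕ) (o : BourdonGroup p q) (n : ℕ) : Type :=
  EuclideanSpace ℂ (OuterLeg (chamberBall o n) → Fin d)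

/-- The bulk-to-boundary map of the network truncated at distance `n`. -/
noncomputable def networkMap (T : ∀ g : BourdonGroup p q, (Leg g → Fin d) → ℂ)
    (o : BourdonGroup p q) (n : ℕ) (ψ : CodeSpace d o n) : PhysSpace d o n :=
  WithLp.toLp 2 fun y => ∑ x, contractedTensor T (chamberBall o n) x y * ψ x

theorem chamberBall_subset_succ (o : BourdonGroup p q) (n : ℕ) :
    chamberBall o n ⊆ chamberBall o (n + 1) := by
  intro g hg
  rw [chamberBall, Set.Finite.mem_toFinset] at hg ⊢
  exact le_trans (show (chamberGraph p q).edist o g ≤ n from hg) (by exact_mod_cast n.le_succ)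

theorem nextLayer_subset (o : BourdonGroup p q) (n : ℕ) :
    nextLayer o n ⊆ chamberBall o (n + 1) := Finset.sdiff_subset

/-- The map `ψ ↦ ψ ⊗ |ref⟩ ⊗ ⋯ ⊗ |ref⟩`, with one factor `|ref⟩` for each bulk leg of
layer `n + 1`. -/
noncomputable def tensorRef (ref : EuclideanSpace ℂ (Fin d)) (o : BourdonGroup p q) (n : ℕ)
    (ψ : CodeSpace d o n) : CodeSpace d o (n + 1) :=
  WithLp.toLp 2 fun x =>
    ψ (fun k => x (⟨k.1.1, chamberBall_subset_succ o n k.1.2⟩, k.2)) *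
      ∏ k : BulkLeg (nextLayer o n), ref (x (⟨k.1.1, nextLayer_subset o n k.1.2⟩, k.2))

theorem mem_nextLayer {o : BourdonGroup p q} {n : ℕ} {g : BourdonGroup p q} :
    g ∈ nextLayer o n ↔ g ∈ chamberBall o (n + 1) ∧ g ∉ chamberBall o n := Finset.mem_sdiff

/-- Values on the cut legs of layer `n + 1`, given values `y` on the boundary legs of the network
truncated at `n` (shared with the chambers of layer `n`) and values `y'` on the boundary legs of
the network truncated at `n + 1`. -/
noncomputable def glueLayer (o : BourdonGroup p q) (n : ℕ)
    (y : OuterLeg (chamberBall o n) → Fin d) (y' : OuterLeg (chamberBall o (n + 1)) → Fin d) :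
    OuterLeg (nextLayer o n) → Fin d :=
  fun e =>
    if h : e.1.2 ∈ chamberBall o n then
      y ⟨(e.1.2, e.1.1), h, (mem_nextLayer.mp e.2.1).2, e.2.2.2.symm⟩
    else
      y' ⟨e.1, nextLayer_subset o n e.2.1,
        fun h' => e.2.2.1 (mem_nextLayer.mpr ⟨h', h⟩), e.2.2.2⟩

/-- The boundary-to-boundary map: a state on the boundary legs of the network truncated at `n` is
mapped through the tensors of layer `n + 1`, with all dangling bulk legs of that layer in the
state `|ref⟩`. -/
noncomputable def layerMap (T : ∀ g : BourdonGroup p q, (Leg g → Fin d) → ℂ)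
    (ref : EuclideanSpace ℂ (Fin d)) (o : BourdonGroup p q) (n : ℕ)
    (φ : PhysSpace d o n) : PhysSpace d o (n + 1) :=
  WithLp.toLp 2 fun y' =>
    ∑ y, (∑ x, contractedTensor T (nextLayer o n) x (glueLayer o n y y') * ∏ k, ref (x k)) * φ y

end Network

universe w

/-!
The chambers are the elements of a graph product of cyclic groups over the `p`-cycle. The distance
from `o` to a chamber `g` is its *height*, the number of syllables of a reduced word for `o⁻¹ g`. To
know how the height changes along an edge, the group is made to act on *pilings*, a normal form for
reduced words up to commutation (`Piling.Spells`, `Piling.actHom`, `edist_eq_height`). The edge of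
type `i` of `g` leads to chambers that are not further away only if the reduced word of `g` can end
in a power of `s_i`. Such generators commute pairwise, so that there are at most two of them in the
`p`-cycle. Therefore at most `2 (q - 1)` of the `p (q - 1)` neighbours of a chamber are not further
away, and since `p ≥ 5` these neighbours and the bulk legs make up at most half of all legs
(`card_legs_le`).

Consequently a finite part `D` of the network can be built by attaching its chambers in order of
height. Each perfect tensor is then used as a map from its bulk legs and its legs to the chambers
already present to its other legs, where it is proportional to an isometry, and so the contraction
on `D` is proportional to an isometry from all bulk legs and all legs to lower chambers to the
remaining cut legs (`exists_gram_amplitude`; the statement is about the Gram matrix of this map).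
With `D` a ball this gives the isometry of the bulk-to-boundary map `N`, and with `D` the next layer
that of the boundary-to-boundary map `M`. Contracting the next ball in two steps gives
`M N = N j` with `j` the tensoring with reference states (`layerMap_networkMap`), and comparison of
norms shows that the scaling factors match. The passage to the limit is formal: isometries extend by
continuity from the union of the stages, and the dimensions of the stages are unbounded because
every chamber has a neighbour further away from `o`.
-/

/-! ### Direct limits of Hilbert spaces -/

section HilbertLimitLemmas

universe u v

variable {E : ℕ → Type u} [∀ n, NormedAddCommGroup (E n)] [∀ n, InnerProductSpace ℂ (E n)]

theorem hilbertLimitOf_succ (f : ∀ n, E n →ₗᵢ[ℂ] E (n + 1)) (n : ℕ) (x : E n) :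
    hilbertLimitOf f (n + 1) (f n x) = hilbertLimitOf f n x := by
  have h : (⟦⟨n + 1, f n x⟩⟧ : AlgLimit f) = ⟦⟨n, x⟩⟧ := by
    rw [DirectLimit.eq_of_le ⟨n, x⟩ (n + 1) n.le_succ, isomTrans_succ f n n le_rfl,
      isomTrans_self]
  exact congrArg (fun z : AlgLimit f => (z : HilbertLimit f)) h

/-- The images of the stages are dense in the limit. -/
theorem hilbertLimit_induction (f : ∀ n, E n →ₗᵢ[ℂ] E (n + 1)) {P : HilbertLimit f → Prop}
    (hP : IsClosed {z | P z}) (h : ∀ n x, P (hilbertLimitOf f n x)) (z : HilbertLimit f) : P z := by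
  refine UniformSpace.Completion.induction_on z hP fun a => ?_
  induction a using DirectLimit.induction with
  | _ n x => exact h n x

theorem hilbertLimit_clm_ext (f : ∀ n, E n →ₗᵢ[ℂ] E (n + 1)) {K : Type v} [NormedAddCommGroup K]
    [NormedSpace ℂ K] {G G' : HilbertLimit f →L[ℂ] K}
    (h : ∀ n x, G (hilbertLimitOf f n x) = G' (hilbertLimitOf f n x)) : G = G' :=
  ContinuousLinearMap.ext fun z =>
    hilbertLimit_induction f (isClosed_eq G.continuous G'.continuous) h z

/-- The map out of the algebraic limit given by a compatible family. -/
noncomputable def algLimitDesc (f : ∀ n, E n →ₗᵢ[ℂ] E (n + 1)) {K : Type v} [NormedAddCommGroup K]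
    [NormedSpace ℂ K] (g : ∀ n, E n →L[ℂ] K) (hc : ∀ n x, g (n + 1) (f n x) = g n x) :
    AlgLimit f →ₗ[ℂ] K where
  toFun := DirectLimit.lift (isomTrans f) (fun n x => g n x) (fun i j h x => by
    induction h with
    | refl => rw [isomTrans_self]
    | step h ih => rw [isomTrans_succ f _ _ h, hc, ih])
  map_add' := DirectLimit.induction₂ _ fun n x y => by
    rw [DirectLimit.add_def]
    exact map_add (g n) x y
  map_smul' r := DirectLimit.induction _ fun n x => by
    rw [DirectLimit.smul_def]
    exact map_smul (g n) r x

theorem isHilbertDirectLimit_hilbertLimitOf (f : ∀ n, E n →ₗᵢ[ℂ] E (n + 1)) :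
    IsHilbertDirectLimit.{u, v} f (hilbertLimitOf f) := by
  refine ⟨hilbertLimitOf_succ f, fun K _ _ _ C g hC hg hc => ?_⟩
  let e : AlgLimit f →ₗ[ℂ] HilbertLimit f := UniformSpace.Completion.toComplₗᵢ.toLinearMap
  have hdense : DenseRange e := UniformSpace.Completion.denseRange_coe
  have hbound : ∀ z, ‖algLimitDesc f g hc z‖ ≤ C * ‖e z‖ :=
    DirectLimit.induction _ fun n x => by
      have hx : ‖e ⟦⟨n, x⟩⟧‖ = ‖x‖ := (hilbertLimitOf f n).norm_map x
      rw [hx]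
      exact (g n).le_of_opNorm_le (hg n) x
  have hext : ∀ n x, (algLimitDesc f g hc).extendOfNorm e (hilbertLimitOf f n x) = g n x :=
    fun n x => LinearMap.extendOfNorm_eq hdense ⟨C, hbound⟩ (algLimitOf f n x)
  exact ⟨(algLimitDesc f g hc).extendOfNorm e, LinearMap.opNorm_extendOfNorm_le hdense hC hbound,
    hext, fun G' hG' => hilbertLimit_clm_ext f fun n x => (hG' n x).trans (hext n x).symm⟩

/-- A compatible family of isometries between the stages of two sequences induces a unique isometry
between the limits. -/
theorem existsUnique_hilbertLimit_map {F : ℕ → Type u} [∀ n, NormedAddCommGroup (F n)]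
    [∀ n, InnerProductSpace ℂ (F n)] (f : ∀ n, E n →ₗᵢ[ℂ] E (n + 1))
    (f' : ∀ n, F n →ₗᵢ[ℂ] F (n + 1)) (U : ∀ n, E n →ₗᵢ[ℂ] F n)
    (hU : ∀ n x, U (n + 1) (f n x) = f' n (U n x)) :
    ∃! w : HilbertLimit f →ₗᵢ[ℂ] HilbertLimit f',
      ∀ n x, w (hilbertLimitOf f n x) = hilbertLimitOf f' n (U n x) := by
  obtain ⟨G, -, hG, -⟩ := (isHilbertDirectLimit_hilbertLimitOf f).2 (HilbertLimit f') 1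
    (fun n => ((hilbertLimitOf f' n).comp (U n)).toContinuousLinearMap) zero_le_one
    (fun n => LinearIsometry.norm_toContinuousLinearMap_le _)
    (fun n x => by
      change hilbertLimitOf f' (n + 1) (U (n + 1) (f n x)) = hilbertLimitOf f' n (U n x)
      rw [hU, hilbertLimitOf_succ])
  refine ⟨⟨G.toLinearMap, hilbertLimit_induction f
    (isClosed_eq G.continuous.norm continuous_norm) fun n x => ?_⟩, hG, fun w hw => ?_⟩
  · rw [ContinuousLinearMap.coe_coe, hG]
    simp
  · ext z
    refine hilbertLimit_induction f (P := fun z => w z = G z)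
      (isClosed_eq w.continuous G.continuous) (fun n x => ?_) z
    rw [hw, hG]
    simp

/-- The limit has infinite dimension if the dimensions of the stages are unbounded. -/
theorem not_finiteDimensional_hilbertLimit [∀ n, FiniteDimensional ℂ (E n)]
    (f : ∀ n, E n →ₗᵢ[ℂ] E (n + 1)) (h : ∀ N, ∃ n, N < Module.finrank ℂ (E n)) :
    ¬ FiniteDimensional ℂ (HilbertLimit f) := by
  intro hfin
  obtain ⟨n, hn⟩ := h (Module.finrank ℂ (HilbertLimit f))
  exact absurd (LinearMap.finrank_le_finrank_of_injective
    (f := (hilbertLimitOf f n).toLinearMap) (hilbertLimitOf f n).injective) hn.not_ge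

end HilbertLimitLemmas

/-! ### Pilings: a normal form for the Bourdon group -/

section Pilings

variable {p q : ℕ}

/-- The generators `s_i` and `s_j` are distinct and not declared to commute. -/
def Linked (i j : ZMod p) : Prop := j ≠ i ∧ j ≠ i + 1 ∧ i ≠ j + 1

theorem Linked.symm {i j : ZMod p} (h : Linked i j) : Linked j i := ⟨h.1.symm, h.2.2, h.2.1⟩

/-- The power `s_i ^ k` with the exponent taken modulo `q`. -/
noncomputable def genPow (i : ZMod p) (k : ZMod q) : BourdonGroup p q :=
  (ZMod.lift q ⟨zmultiplesHom _ (Additive.ofMul (bourdonGen p q i)), by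
    rw [zmultiplesHom_apply, natCast_zsmul, ← ofMul_pow, bourdonGen_pow, ofMul_one]⟩ k).toMul

theorem genPow_add (i : ZMod p) (k l : ZMod q) : genPow i (k + l) = genPow i k * genPow i l := by
  simp [genPow]

theorem genPow_zero (i : ZMod p) : genPow i (0 : ZMod q) = 1 := by
  simp [genPow]

theorem genPow_intCast (i : ZMod p) (m : ℤ) : genPow i (m : ZMod q) = bourdonGen p q i ^ m := by
  simp [genPow]

theorem genPow_one (i : ZMod p) : genPow i (1 : ZMod q) = bourdonGen p q i := by
  simpa using genPow_intCast (q := q) i 1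

theorem genPow_neg_one (i : ZMod p) : genPow i (-1 : ZMod q) = (bourdonGen p q i)⁻¹ := by
  simpa using genPow_intCast (q := q) i (-1)

theorem exists_zpow_eq_genPow (i : ZMod p) (k : ZMod q) :
    ∃ m : ℤ, bourdonGen p q i ^ m = genPow i k := by
  obtain ⟨m, rfl⟩ := ZMod.intCast_surjective k
  exact ⟨m, (genPow_intCast i m).symm⟩

theorem bourdonGen_commute_succ (i : ZMod p) :
    Commute (bourdonGen p q i) (bourdonGen p q (i + 1)) := by
  have h := PresentedGroup.one_of_mem (rels := bourdonRels p q)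
    (x := FreeGroup.of i * FreeGroup.of (i + 1) * (FreeGroup.of i)⁻¹ * (FreeGroup.of (i + 1))⁻¹)
    ⟨i, Or.inr rfl⟩
  rw [← commutatorElement_eq_one_iff_commute, commutatorElement_def]
  simpa [bourdonGen, PresentedGroup.of] using h

theorem genPow_commute {i j : ZMod p} (hij : ¬ Linked i j) (k l : ZMod q) :
    Commute (genPow i k) (genPow j l) := by
  obtain ⟨m, hm⟩ := exists_zpow_eq_genPow i k
  obtain ⟨n, hn⟩ := exists_zpow_eq_genPow j l
  rw [← hm, ← hn]
  refine Commute.zpow_zpow ?_ m n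
  by_cases h1 : j = i
  · rw [h1]
  by_cases h2 : j = i + 1
  · rw [h2]
    exact bourdonGen_commute_succ i
  by_cases h3 : i = j + 1
  · rw [h3]
    exact (bourdonGen_commute_succ j).symm
  exact absurd ⟨h1, h2, h3⟩ hij

/-- A piling: one stack for each generator. The nonzero entries of stack `i` are the exponents of
the syllables `s_i ^ k` of a word; an entry `0` is a mark left by a syllable of a generator that
does not commute with `s_i`. -/
abbrev Piling (p q : ℕ) : Type := ZMod p → List (ZMod q)

namespace Piling

/-- The exponent on top of stack `i`, or `0` if the stack is empty or has a mark on top. -/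
def letter (x : Piling p q) (i : ZMod p) : ZMod q := (x i).headD 0

open Classical in
/-- Write the syllable `s_i ^ k` after the word of a piling. -/
noncomputable def push (i : ZMod p) (k : ZMod q) (x : Piling p q) : Piling p q :=
  fun j => if j = i then k :: x j else if Linked i j then 0 :: x j else x j

open Classical in
/-- Remove the syllable on top of stack `i`, together with its marks. -/
noncomputable def pop (i : ZMod p) (x : Piling p q) : Piling p q :=
  fun j => if j = i ∨ Linked i j then (x j).tail else x j

/-- The number of syllables of a piling. -/
def weight [NeZero p] (x : Piling p q) : ℕ := ∑ i, (x i).countP (· ≠ 0)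

/-- The reduced pilings, each with the group element that it spells: those that arise from the
empty piling by writing nontrivial syllables that do not merge with an earlier one. -/
inductive Spells : Piling p q → BourdonGroup p q → Prop
  | empty : Spells (fun _ => []) 1
  | push {x : Piling p q} {g : BourdonGroup p q} (i : ZMod p) (k : ZMod q) :
      Spells x g → x.letter i = 0 → k ≠ 0 → Spells (x.push i k) (g * genPow i k)

theorem letter_push_self (i : ZMod p) (k : ZMod q) (x : Piling p q) :
    (x.push i k).letter i = k := by
  simp [letter, push]

theorem letter_push_linked {i j : ZMod p} (h : Linked i j) (k : ZMod q) (x : Piling p q) :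
    (x.push i k).letter j = 0 := by
  simp [letter, push, h, h.1]

theorem letter_push_of_ne {i j : ZMod p} (hne : j ≠ i) (h : ¬ Linked i j) (k : ZMod q)
    (x : Piling p q) : (x.push i k).letter j = x.letter j := by
  simp [letter, push, h, hne]

theorem pop_push_self (i : ZMod p) (k : ZMod q) (x : Piling p q) : (x.push i k).pop i = x := by
  funext m
  by_cases hm : m = i
  · subst hm
    simp [push, pop]
  · by_cases hl : Linked i m <;> simp [push, pop, hm, hl]

theorem push_comm {i j : ZMod p} (hne : j ≠ i) (h : ¬ Linked i j) (k l : ZMod q)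
    (x : Piling p q) : (x.push i k).push j l = (x.push j l).push i k := by
  have h' := mt Linked.symm h
  funext m
  unfold push
  split_ifs <;> simp_all

theorem pop_comm (i j : ZMod p) (x : Piling p q) : (x.pop i).pop j = (x.pop j).pop i := by
  funext m
  unfold pop
  split_ifs <;> rfl

theorem letter_pop_of_ne {i j : ZMod p} (hne : j ≠ i) (h : ¬ Linked i j) (x : Piling p q) :
    (x.pop i).letter j = x.letter j := by
  simp [letter, pop, h, hne]

theorem pop_push_comm {i j : ZMod p} (hne : j ≠ i) (h : ¬ Linked i j) (k : ZMod q)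
    {x : Piling p q} (hx : ∀ m, Linked i m → ∃ l, x m = 0 :: l) :
    (x.push j k).pop i = (x.pop i).push j k := by
  have h' := mt Linked.symm h
  funext m
  by_cases hm : Linked i m
  · obtain ⟨l, hl⟩ := hx m hm
    have hmj : m ≠ j := by rintro rfl; exact h hm
    by_cases hjm : Linked j m <;> simp [push, pop, hm, hmj, hl, hjm]
  · by_cases hmi : m = i
    · subst hmi
      simp [push, pop, hne.symm, h']
    · simp [push, pop, hm, hmi]

/-- If `s_i` is a last letter of a reduced piling, the stacks linked to `i` have marks on top. -/
theorem Spells.exists_mark {x : Piling p q} {g : BourdonGroup p q} (hx : Spells x g) {i m : ZMod p}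
    (hi : x.letter i ≠ 0) (hm : Linked i m) : ∃ l, x m = 0 :: l := by
  induction hx with
  | empty => exact absurd rfl hi
  | @push y g j k hy hj hk ih =>
    by_cases hij : i = j
    · subst hij
      exact ⟨y m, by simp [Piling.push, hm, hm.1]⟩
    · by_cases hl : Linked j i
      · exact absurd (letter_push_linked hl k y) hi
      · rw [letter_push_of_ne hij hl] at hi
        obtain ⟨l, hl'⟩ := ih hi
        have hmj : m ≠ j := by rintro rfl; exact hl hm.symm
        by_cases hjm : Linked j m
        · exact ⟨y m, by simp [Piling.push, hjm, hmj]⟩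
        · exact ⟨l, by simp [Piling.push, hjm, hmj, hl']⟩

theorem Spells.letter_eq_zero {x : Piling p q} {g : BourdonGroup p q} (hx : Spells x g)
    {i m : ZMod p} (hi : x.letter i ≠ 0) (hm : Linked i m) : x.letter m = 0 := by
  obtain ⟨l, hl⟩ := hx.exists_mark hi hm
  simp [letter, hl]

/-- The syllable on top of a stack of a reduced piling can be removed and written again: the later
syllables commute with it. -/
theorem Spells.pop {x : Piling p q} {g : BourdonGroup p q} (hx : Spells x g) {i : ZMod p}
    (hi : x.letter i ≠ 0) : Spells (x.pop i) (g * genPow i (-x.letter i)) ∧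
      (x.pop i).letter i = 0 ∧ (x.pop i).push i (x.letter i) = x := by
  induction hx with
  | empty => exact absurd rfl hi
  | @push y g j k hy hj hk ih =>
    by_cases hij : i = j
    · subst hij
      rw [pop_push_self, letter_push_self, mul_assoc, ← genPow_add, add_neg_cancel, genPow_zero,
        mul_one]
      exact ⟨hy, hj, rfl⟩
    · by_cases hl : Linked j i
      · exact absurd (letter_push_linked hl k y) hi
      · have hl' := mt Linked.symm hl
        rw [letter_push_of_ne hij hl] at hi ⊢
        obtain ⟨h1, h2, h3⟩ := ih hi
        rw [pop_push_comm (Ne.symm hij) hl' k fun m hm => hy.exists_mark hi hm]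
        refine ⟨?_, ?_, ?_⟩
        · rw [mul_assoc, (genPow_commute hl k (-y.letter i)).eq, ← mul_assoc]
          exact h1.push j k (by rwa [letter_pop_of_ne (Ne.symm hij) hl']) hk
        · rwa [letter_push_of_ne hij hl]
        · rw [push_comm hij hl, h3]

theorem weight_push [NeZero p] (i : ZMod p) {k : ZMod q} (hk : k ≠ 0) (x : Piling p q) :
    (x.push i k).weight = x.weight + 1 := by
  have h : ∀ j, (x.push i k j).countP (· ≠ 0) = (x j).countP (· ≠ 0) + if j = i then 1 else 0 := by
    intro j
    unfold push
    split_ifs <;> simp [hk]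
  simp only [weight, h, Finset.sum_add_distrib, Finset.sum_ite_eq', Finset.mem_univ, if_true]

/-- Remove the syllable on top of stack `i`, if there is one. -/
noncomputable def strip (i : ZMod p) (x : Piling p q) : Piling p q :=
  if x.letter i = 0 then x else x.pop i

/-- Write the syllable `s_i ^ k`, unless it is trivial. -/
noncomputable def put (i : ZMod p) (k : ZMod q) (x : Piling p q) : Piling p q :=
  if k = 0 then x else x.push i k

/-- The effect on reduced pilings of right multiplication by `s_i ^ k`. -/
noncomputable def act (i : ZMod p) (k : ZMod q) (x : Piling p q) : Piling p q :=
  (x.strip i).put i (x.letter i + k)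

theorem Spells.strip {x : Piling p q} {g : BourdonGroup p q} (hx : Spells x g) (i : ZMod p) :
    Spells (x.strip i) (g * genPow i (-x.letter i)) := by
  unfold Piling.strip
  split_ifs with h
  · rwa [h, neg_zero, genPow_zero, mul_one]
  · exact (hx.pop h).1

theorem Spells.letter_strip {x : Piling p q} {g : BourdonGroup p q} (hx : Spells x g)
    (i : ZMod p) : (x.strip i).letter i = 0 := by
  unfold Piling.strip
  split_ifs with h
  · exact h
  · exact (hx.pop h).2.1

theorem Spells.put_strip {x : Piling p q} {g : BourdonGroup p q} (hx : Spells x g)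
    (i : ZMod p) : (x.strip i).put i (x.letter i) = x := by
  unfold Piling.strip Piling.put
  split_ifs with h
  · rfl
  · exact (hx.pop h).2.2

theorem Spells.put {x : Piling p q} {g : BourdonGroup p q} (hx : Spells x g) {i : ZMod p}
    (hi : x.letter i = 0) (k : ZMod q) : Spells (x.put i k) (g * genPow i k) := by
  unfold Piling.put
  split_ifs with h
  · rwa [h, genPow_zero, mul_one]
  · exact hx.push i k hi h

theorem letter_put_self {x : Piling p q} {i : ZMod p} (hi : x.letter i = 0) (k : ZMod q) :
    (x.put i k).letter i = k := by
  unfold put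
  split_ifs with h
  · rw [hi, h]
  · exact letter_push_self i k x

theorem strip_put_self {x : Piling p q} {i : ZMod p} (hi : x.letter i = 0) (k : ZMod q) :
    (x.put i k).strip i = x := by
  rw [strip, letter_put_self hi, put]
  split_ifs with h
  · rfl
  · exact pop_push_self i k x

theorem Spells.act {x : Piling p q} {g : BourdonGroup p q} (hx : Spells x g) (i : ZMod p)
    (k : ZMod q) : Spells (x.act i k) (g * genPow i k) := by
  have h := (hx.strip i).put (hx.letter_strip i) (x.letter i + k)
  rwa [mul_assoc, ← genPow_add, neg_add_cancel_left] at h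

theorem Spells.letter_act_self {x : Piling p q} {g : BourdonGroup p q} (hx : Spells x g)
    (i : ZMod p) (k : ZMod q) : (x.act i k).letter i = x.letter i + k :=
  letter_put_self (hx.letter_strip i) _

theorem Spells.act_act {x : Piling p q} {g : BourdonGroup p q} (hx : Spells x g) (i : ZMod p)
    (k l : ZMod q) : (x.act i k).act i l = x.act i (k + l) := by
  rw [Piling.act, hx.letter_act_self, Piling.act, strip_put_self (hx.letter_strip i), Piling.act,
    add_assoc]

theorem Spells.act_zero {x : Piling p q} {g : BourdonGroup p q} (hx : Spells x g) (i : ZMod p) :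
    x.act i 0 = x := by
  rw [Piling.act, add_zero, hx.put_strip]

theorem letter_strip_of_ne {i j : ZMod p} (hne : j ≠ i) (h : ¬ Linked i j) (x : Piling p q) :
    (x.strip i).letter j = x.letter j := by
  unfold strip
  split_ifs
  · rfl
  · exact letter_pop_of_ne hne h x

theorem letter_put_of_ne {i j : ZMod p} (hne : j ≠ i) (h : ¬ Linked i j) (k : ZMod q)
    (x : Piling p q) : (x.put i k).letter j = x.letter j := by
  unfold put
  split_ifs
  · rfl
  · exact letter_push_of_ne hne h k x

theorem letter_act_of_ne {i j : ZMod p} (hne : j ≠ i) (h : ¬ Linked i j) (k : ZMod q)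
    (x : Piling p q) : (x.act i k).letter j = x.letter j := by
  rw [act, letter_put_of_ne hne h, letter_strip_of_ne hne h]

theorem strip_comm {i j : ZMod p} (hne : j ≠ i) (h : ¬ Linked i j) (x : Piling p q) :
    (x.strip i).strip j = (x.strip j).strip i := by
  rw [strip, letter_strip_of_ne hne h, strip.eq_def i (x.strip j),
    letter_strip_of_ne hne.symm (mt Linked.symm h)]
  unfold strip
  split_ifs
  · rfl
  · rfl
  · rfl
  · exact pop_comm i j x

theorem put_comm {i j : ZMod p} (hne : j ≠ i) (h : ¬ Linked i j) (k l : ZMod q)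
    (x : Piling p q) : (x.put i k).put j l = (x.put j l).put i k := by
  unfold put
  split_ifs
  · rfl
  · rfl
  · rfl
  · exact push_comm hne h k l x

theorem Spells.strip_put_comm {x : Piling p q} {g : BourdonGroup p q} (hx : Spells x g)
    {i j : ZMod p} (hne : j ≠ i) (h : ¬ Linked i j) (k : ZMod q) :
    (x.put j k).strip i = (x.strip i).put j k := by
  rw [Piling.strip, letter_put_of_ne hne.symm (mt Linked.symm h), Piling.strip]
  unfold Piling.put
  split_ifs with h1
  · rfl
  · rfl
  · rfl
  · exact pop_push_comm hne h k fun m hm => hx.exists_mark h1 hm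

theorem Spells.act_comm {x : Piling p q} {g : BourdonGroup p q} (hx : Spells x g)
    {i j : ZMod p} (hne : j ≠ i) (h : ¬ Linked i j) (k l : ZMod q) :
    (x.act i k).act j l = (x.act j l).act i k := by
  have h' := mt Linked.symm h
  rw [Piling.act, letter_act_of_ne hne h, Piling.act, (hx.strip i).strip_put_comm hne.symm h',
    put_comm hne h, strip_comm hne h, Piling.act.eq_def i k (x.act j l),
    letter_act_of_ne hne.symm h', Piling.act, (hx.strip j).strip_put_comm hne h]

theorem Spells.weight_strip [NeZero p] {x : Piling p q} {g : BourdonGroup p q} (hx : Spells x g)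
    {i : ZMod p} (hi : x.letter i ≠ 0) : (x.strip i).weight + 1 = x.weight := by
  rw [Piling.strip, if_neg hi, ← weight_push i hi, (hx.pop hi).2.2]

theorem weight_act_of_eq_zero [NeZero p] {x : Piling p q} {i : ZMod p} (hi : x.letter i = 0)
    {k : ZMod q} (hk : k ≠ 0) : (x.act i k).weight = x.weight + 1 := by
  rw [act, hi, zero_add, strip, if_pos hi, put, if_neg hk, weight_push i hk]

theorem Spells.weight_act_of_ne_zero [NeZero p] {x : Piling p q} {g : BourdonGroup p q}
    (hx : Spells x g) {i : ZMod p} (hi : x.letter i ≠ 0) (k : ZMod q) :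
    (x.act i k).weight ≤ x.weight := by
  have h := hx.weight_strip hi
  unfold Piling.act Piling.put
  split_ifs with hk
  · omega
  · rw [weight_push i hk]
    omega

/-- Right multiplication by `s_i ^ k` as a permutation of the reduced pilings. -/
noncomputable def actPerm (i : ZMod p) (k : ZMod q) :
    Equiv.Perm {x : Piling p q // ∃ g, Spells x g} where
  toFun x := ⟨x.1.act i k, x.2.imp' (· * genPow i k) fun _ h => h.act i k⟩
  invFun x := ⟨x.1.act i (-k), x.2.imp' (· * genPow i (-k)) fun _ h => h.act i (-k)⟩
  left_inv x := Subtype.ext <| by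
    obtain ⟨g, h⟩ := x.2
    simp only [h.act_act, add_neg_cancel, h.act_zero]
  right_inv x := Subtype.ext <| by
    obtain ⟨g, h⟩ := x.2
    simp only [h.act_act, neg_add_cancel, h.act_zero]

theorem actPerm_pow (i : ZMod p) (n : ℕ) :
    actPerm i (1 : ZMod q) ^ n = actPerm i (n : ZMod q) := by
  induction n with
  | zero =>
    ext1 x
    obtain ⟨g, h⟩ := x.2
    exact Subtype.ext (by simp [actPerm, h.act_zero])
  | succ n ih =>
    ext1 x
    obtain ⟨g, h⟩ := x.2
    rw [pow_succ', ih]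
    exact Subtype.ext (by simp [actPerm, h.act_act])

theorem actPerm_comm {i j : ZMod p} (hne : j ≠ i) (h : ¬ Linked i j) (k l : ZMod q) :
    Commute (actPerm i k) (actPerm j l) := by
  ext1 x
  obtain ⟨g, hx⟩ := x.2
  exact Subtype.ext (hx.act_comm hne h k l).symm

/-- The right action of the Bourdon group on the reduced pilings. -/
noncomputable def actHom (p q : ℕ) :
    BourdonGroup p q →* (Equiv.Perm {x : Piling p q // ∃ g, Spells x g})ᵐᵒᵖ :=
  PresentedGroup.toGroup (f := fun i => MulOpposite.op (actPerm i 1)) <| by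
    rintro r ⟨i, rfl | rfl⟩
    · rw [map_pow, FreeGroup.lift_apply_of, ← MulOpposite.op_pow, actPerm_pow, ZMod.natCast_self,
        ← Nat.cast_zero, ← actPerm_pow, pow_zero, MulOpposite.op_one]
    · simp only [map_mul, map_inv, FreeGroup.lift_apply_of]
      rw [← commutatorElement_def, commutatorElement_eq_one_iff_commute]
      by_cases hne : i + 1 = i
      · rw [hne]
        exact Commute.refl _
      · exact (actPerm_comm hne (fun h => h.2.1 rfl) 1 1).op

/-- The reduced piling of a group element. -/
noncomputable def ofGroup (g : BourdonGroup p q) : Piling p q :=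
  ((actHom p q g).unop ⟨fun _ => [], 1, Spells.empty⟩).1

theorem ofGroup_mul_gen (g : BourdonGroup p q) (i : ZMod p) :
    ofGroup (g * bourdonGen p q i) = (ofGroup g).act i 1 := by
  rw [ofGroup, map_mul, MulOpposite.unop_mul, Equiv.Perm.mul_apply]
  have h : actHom p q (bourdonGen p q i) = MulOpposite.op (actPerm i 1) :=
    PresentedGroup.toGroup.of _
  rw [h]
  rfl

theorem exists_spells_ofGroup (g : BourdonGroup p q) : ∃ g', Spells (ofGroup g) g' :=
  ((actHom p q g).unop ⟨fun _ => [], 1, Spells.empty⟩).2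

theorem ofGroup_mul_gen_inv (g : BourdonGroup p q) (i : ZMod p) :
    ofGroup (g * (bourdonGen p q i)⁻¹) = (ofGroup g).act i (-1) := by
  obtain ⟨g', h⟩ := exists_spells_ofGroup (g * (bourdonGen p q i)⁻¹)
  have h2 := ofGroup_mul_gen (g * (bourdonGen p q i)⁻¹) i
  rw [inv_mul_cancel_right] at h2
  rw [h2, h.act_act, add_neg_cancel, h.act_zero]

theorem spells_ofGroup (g : BourdonGroup p q) : Spells (ofGroup g) g := by
  have hg : g ∈ Subgroup.closure (Set.range (PresentedGroup.of (rels := bourdonRels p q))) := by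
    rw [PresentedGroup.closure_range_of]
    trivial
  induction hg using Subgroup.closure_induction_right with
  | one =>
    rw [ofGroup, map_one]
    exact Spells.empty
  | mul_right g hg s hs ih =>
    obtain ⟨i, rfl⟩ := hs
    have h := ih.act i 1
    rwa [genPow_one, ← ofGroup_mul_gen] at h
  | mul_inv_cancel g hg s hs ih =>
    obtain ⟨i, rfl⟩ := hs
    have h := ih.act i (-1)
    rwa [genPow_neg_one, ← ofGroup_mul_gen_inv] at h

theorem ofGroup_mul_genPow (g : BourdonGroup p q) (i : ZMod p) (k : ZMod q) :
    ofGroup (g * genPow i k) = (ofGroup g).act i k := by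
  obtain ⟨m, rfl⟩ := ZMod.intCast_surjective k
  rw [genPow_intCast]
  induction m with
  | zero => simp [(spells_ofGroup g).act_zero]
  | succ n ih =>
    rw [zpow_add_one, ← mul_assoc, ofGroup_mul_gen, ih, (spells_ofGroup g).act_act]
    push_cast
    rfl
  | pred n ih =>
    rw [zpow_sub_one, ← mul_assoc, ofGroup_mul_gen_inv, ih, (spells_ofGroup g).act_act]
    push_cast
    rw [sub_eq_add_neg]

end Piling

end Pilings

/-! ### Heights of chambers -/

section Height

variable {p q : ℕ}

open Piling

theorem chamberGraph_adj_iff {g h : BourdonGroup p q} :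
    (chamberGraph p q).Adj g h ↔ ∃ (i : ZMod p) (k : ZMod q), k ≠ 0 ∧ h = g * genPow i k := by
  constructor
  · rintro ⟨hne, i, hi⟩
    obtain ⟨m, hm⟩ := Subgroup.mem_zpowers_iff.mp (QuotientGroup.eq.mp hi)
    have h1 : h = g * genPow i (m : ZMod q) := by
      rw [genPow_intCast, hm, mul_inv_cancel_left]
    refine ⟨i, m, fun h0 => hne ?_, h1⟩
    rw [h1, h0, genPow_zero, mul_one]
  · rintro ⟨i, k, hk, rfl⟩
    refine ⟨fun h => hk ?_, i, QuotientGroup.eq.mpr ?_⟩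
    · have h1 := (spells_ofGroup g).letter_act_self i k
      rw [← ofGroup_mul_genPow, ← h] at h1
      simpa using h1
    · obtain ⟨m, hm⟩ := exists_zpow_eq_genPow i k
      rw [inv_mul_cancel_left, ← hm]
      exact Subgroup.zpow_mem_zpowers _ m

variable [NeZero p]

/-- The number of syllables of a reduced word for `o⁻¹ g`; it is the distance from `o` to `g`. -/
noncomputable def height (o g : BourdonGroup p q) : ℕ := (ofGroup (o⁻¹ * g)).weight

theorem height_le_of_adj (o : BourdonGroup p q) {g h : BourdonGroup p q}
    (hgh : (chamberGraph p q).Adj g h) : height o h ≤ height o g + 1 := by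
  obtain ⟨i, k, hk, rfl⟩ := chamberGraph_adj_iff.mp hgh
  rw [height, ← mul_assoc, ofGroup_mul_genPow]
  by_cases hi : (ofGroup (o⁻¹ * g)).letter i = 0
  · exact (weight_act_of_eq_zero hi hk).le
  · exact ((spells_ofGroup _).weight_act_of_ne_zero hi k).trans (Nat.le_succ _)

theorem height_self (o : BourdonGroup p q) : height o o = 0 := by
  rw [height, inv_mul_cancel, ofGroup, map_one]
  simp [weight]

theorem height_le_of_walk (o : BourdonGroup p q) {g h : BourdonGroup p q}
    (w : (chamberGraph p q).Walk g h) : height o h ≤ height o g + w.length := by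
  induction w with
  | nil => simp
  | cons hadj w ih =>
    have h1 := height_le_of_adj o hadj
    rw [SimpleGraph.Walk.length_cons]
    omega

/-- Writing a piling syllable by syllable is a walk in the graph of chambers. -/
theorem Piling.Spells.edist_le {x : Piling p q} {g : BourdonGroup p q} (hx : Spells x g)
    (o : BourdonGroup p q) : (chamberGraph p q).edist o (o * g) ≤ x.weight := by
  induction hx with
  | empty => simp
  | @push y g i k hy hi hk ih =>
    have hadj : (chamberGraph p q).Adj (o * g) (o * (g * genPow i k)) :=
      chamberGraph_adj_iff.mpr ⟨i, k, hk, (mul_assoc _ _ _).symm⟩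
    refine (SimpleGraph.edist_triangle (v := o * g)).trans ?_
    rw [weight_push i hk, Nat.cast_add, Nat.cast_one, SimpleGraph.edist_eq_one_iff_adj.mpr hadj]
    gcongr

theorem edist_eq_height (o g : BourdonGroup p q) : (chamberGraph p q).edist o g = height o g := by
  apply le_antisymm
  · have h := (spells_ofGroup (o⁻¹ * g)).edist_le o
    rwa [mul_inv_cancel_left] at h
  · refine le_iInf fun w => ?_
    have h := height_le_of_walk o w
    rw [height_self, zero_add] at h
    exact_mod_cast h

theorem mem_chamberBall [NeZero q] {o g : BourdonGroup p q} {n : ℕ} :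
    g ∈ chamberBall o n ↔ height o g ≤ n := by
  rw [chamberBall, Set.Finite.mem_toFinset, Set.mem_ofPred_eq, edist_eq_height, Nat.cast_le]

/-- The generators along which a reduced word can be shortened pairwise commute, so in a cycle of
length at least `4` there are at most two of them. -/
theorem card_letter_ne_zero_le (hp : 4 ≤ p) (g : BourdonGroup p q) :
    (Finset.univ.filter fun i => (ofGroup g).letter i ≠ 0).card ≤ 2 := by
  by_contra! h
  obtain ⟨a, ha, b, hb, c, hc, hab, hac, hbc⟩ := Finset.two_lt_card.mp h
  simp only [Finset.mem_filter, Finset.mem_univ, true_and] at ha hb hc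
  have key : ∀ {i j}, (ofGroup g).letter i ≠ 0 → (ofGroup g).letter j ≠ 0 → j ≠ i →
      j = i + 1 ∨ i = j + 1 := by
    intro i j hi hj hne
    by_contra! hl
    exact hj ((spells_ofGroup g).letter_eq_zero hi ⟨hne, hl.1, hl.2⟩)
  have hcast : ∀ n : ℕ, 0 < n → n < p → (n : ZMod p) ≠ 0 := fun n h0 hn h =>
    absurd (Nat.le_of_dvd h0 ((ZMod.natCast_eq_zero_iff n p).mp h)) hn.not_ge
  have h1 : (1 : ZMod p) ≠ 0 := by simpa using hcast 1 one_pos (by omega)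
  have h3 : (3 : ZMod p) ≠ 0 := by simpa using hcast 3 three_pos (by omega)
  have e1 := key ha hb hab.symm
  have e2 := key ha hc hac.symm
  have e3 := key hb hc hbc.symm
  grind

/-- Each chamber has at least as many legs to chambers further away from `o` as other legs. -/
theorem card_legs_le [NeZero q] (hp : 5 ≤ p) (o g : BourdonGroup p q) :
    (Finset.univ.filter fun h : {h // (chamberGraph p q).Adj g h} =>
        height o h.1 ≤ height o g).card + (q - 1) ≤
      (Finset.univ.filter fun h : {h // (chamberGraph p q).Adj g h} =>
        height o g < height o h.1).card := by
  classical
  set x := ofGroup (o⁻¹ * g) with hx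
  have hs : Spells x (o⁻¹ * g) := spells_ofGroup _
  have hact : ∀ i k, ofGroup (o⁻¹ * (g * genPow i k)) = x.act i k := fun i k => by
    rw [← mul_assoc, ofGroup_mul_genPow]
  set D := Finset.univ.filter fun i => x.letter i ≠ 0 with hD
  have hDcard : D.card ≤ 2 := card_letter_ne_zero_le (by omega) _
  set Q := Finset.univ.filter fun k : ZMod q => k ≠ 0 with hQ
  have hQcard : Q.card = q - 1 := by
    rw [hQ, Finset.filter_ne', Finset.card_erase_of_mem (Finset.mem_univ _), Finset.card_univ,
      ZMod.card]
  have hup : (Dᶜ ×ˢ Q).card ≤ (Finset.univ.filter fun h : {h // (chamberGraph p q).Adj g h} =>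
      height o g < height o h.1).card := by
    rw [← Finset.card_map (Function.Embedding.subtype _)]
    refine Finset.card_le_card_of_injOn (fun a => g * genPow a.1 a.2) ?_ ?_
    · rintro ⟨i, k⟩ hik
      simp only [hD, hQ, Finset.coe_product, Set.mem_prod, Finset.mem_coe, Finset.mem_compl,
        Finset.mem_filter, Finset.mem_univ, true_and, not_not] at hik
      simp only [Finset.coe_map, Set.mem_image, Finset.mem_coe, Finset.mem_filter,
        Finset.mem_univ, true_and]
      refine ⟨⟨g * genPow i k, chamberGraph_adj_iff.mpr ⟨i, k, hik.2, rfl⟩⟩, ?_, rfl⟩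
      rw [height, height, hact, weight_act_of_eq_zero hik.1 hik.2]
      exact Nat.lt_succ_self _
    · rintro ⟨i, k⟩ hik ⟨j, l⟩ hjl heq
      simp only [hD, hQ, Finset.coe_product, Set.mem_prod, Finset.mem_coe, Finset.mem_compl,
        Finset.mem_filter, Finset.mem_univ, true_and, not_not] at hik hjl heq
      have h1 : x.act i k = x.act j l := by rw [← hact, ← hact, heq]
      have h2 : (x.act j l).letter i = k := by
        rw [← h1, hs.letter_act_self, hik.1, zero_add]
      have h3 : (x.act j l).letter j = l := by
        rw [hs.letter_act_self, hjl.1, zero_add]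
      by_cases hij : i = j
      · subst hij
        exact Prod.ext rfl (h2.symm.trans h3)
      · exfalso
        by_cases hl : Linked i j
        · refine hjl.2 ?_
          rw [← h3]
          exact (hs.act j l).letter_eq_zero (h2.trans_ne hik.2) hl
        · refine hik.2 ?_
          rw [← h2, letter_act_of_ne hij (mt Linked.symm hl), hik.1]
  have hdown : (Finset.univ.filter fun h : {h // (chamberGraph p q).Adj g h} =>
      height o h.1 ≤ height o g).card ≤ (D ×ˢ Q).card := by
    rw [← Finset.card_map (Function.Embedding.subtype _)]
    refine (Finset.card_le_card fun h hh => ?_).trans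
      (Finset.card_image_le (f := fun a : ZMod p × ZMod q => g * genPow a.1 a.2))
    obtain ⟨⟨h, hadj⟩, hh', rfl⟩ := Finset.mem_map.mp hh
    obtain ⟨i, k, hk, rfl⟩ := chamberGraph_adj_iff.mp hadj
    refine Finset.mem_image.mpr ⟨(i, k), ?_, rfl⟩
    simp only [hD, hQ, Finset.mem_product, Finset.mem_filter, Finset.mem_univ, true_and]
    refine ⟨fun hi => ?_, hk⟩
    have h1 : height o (g * genPow i k) ≤ height o g := (Finset.mem_filter.mp hh').2
    rw [height, height, hact, ← hx, weight_act_of_eq_zero hi hk] at h1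
    omega
  have hDc : 3 ≤ Dᶜ.card := by
    rw [Finset.card_compl, ZMod.card]
    omega
  rw [Finset.card_product, hQcard] at hup hdown
  calc _ ≤ D.card * (q - 1) + (q - 1) := Nat.add_le_add_right hdown _
    _ ≤ 2 * (q - 1) + (q - 1) := by gcongr
    _ = 3 * (q - 1) := by ring
    _ ≤ Dᶜ.card * (q - 1) := by gcongr
    _ ≤ _ := hup

/-- The balls grow with their radius. -/
theorem lt_card_chamberBall [NeZero q] (hp : 5 ≤ p) (hq : 2 ≤ q) (o : BourdonGroup p q) (n : ℕ) :
    n < (chamberBall o n).card := by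
  have h : ∀ n, ∃ g, height o g = n := by
    intro n
    induction n with
    | zero => exact ⟨o, height_self o⟩
    | succ n ih =>
      obtain ⟨g, rfl⟩ := ih
      have hpos : 0 < (Finset.univ.filter fun h : {h // (chamberGraph p q).Adj g h} =>
          height o g < height o h.1).card := by
        have := card_legs_le hp o g
        omega
      obtain ⟨h, hh⟩ := Finset.card_pos.mp hpos
      exact ⟨h.1, le_antisymm (height_le_of_adj o h.2) (Finset.mem_filter.mp hh).2⟩
  choose f hf using h
  rw [← Nat.succ_le_iff, ← Finset.card_range n.succ]
  refine Finset.card_le_card_of_injOn f (fun k hk => ?_) fun k _ l _ hkl => ?_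
  · rw [Finset.mem_coe, mem_chamberBall, hf]
    exact Nat.lt_succ_iff.mp (Finset.mem_range.mp hk)
  · rw [← hf k, hkl, hf]

end Height

/-! ### Matrices that are proportional to isometries -/

section Gram

open ComplexConjugate

variable {X Y : Type*} [Fintype X]

/-- The linear map with matrix `K`, on Euclidean spaces. -/
noncomputable def kernelMap (K : X → Y → ℂ) : EuclideanSpace ℂ X →ₗ[ℂ] EuclideanSpace ℂ Y where
  toFun v := WithLp.toLp 2 fun y => ∑ x, K x y * v x
  map_add' v w := by
    ext y
    simp [mul_add, Finset.sum_add_distrib]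
  map_smul' r v := by
    ext y
    simp [Finset.mul_sum, mul_left_comm]

theorem kernelMap_apply (K : X → Y → ℂ) (v : EuclideanSpace ℂ X) (y : Y) :
    kernelMap K v y = ∑ x, K x y * v x := rfl

variable [Fintype Y] [DecidableEq X]

theorem gram_of_norm_kernelMap (K : X → Y → ℂ) (c : ℝ) (h : ∀ v, ‖kernelMap K v‖ = c * ‖v‖)
    (x x' : X) : ∑ y, conj (K x y) * K x' y = if x = x' then ((c ^ 2 : ℝ) : ℂ) else 0 := by
  have hinner : ∀ v w, inner ℂ (kernelMap K v) (kernelMap K w) =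
      ((c ^ 2 : ℝ) : ℂ) * inner ℂ v w := by
    intro v w
    rw [inner_eq_sum_norm_sq_div_four, inner_eq_sum_norm_sq_div_four, ← map_smul, ← map_add,
      ← map_sub, ← map_add, ← map_sub, h, h, h, h]
    push_cast [RCLike.ofReal_eq_complex_ofReal]
    ring
  have hs : ∀ x y, kernelMap K (EuclideanSpace.single x 1) y = K x y := by
    intro x y
    simp [kernelMap_apply]
  have h1 := hinner (EuclideanSpace.single x 1) (EuclideanSpace.single x' 1)
  simp only [PiLp.inner_apply, hs, RCLike.inner_apply] at h1
  simp only [mul_comm (conj _)]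
  rw [h1]
  simp

theorem norm_sq_kernelMap_of_gram (K : X → Y → ℂ) (C : ℝ)
    (h : ∀ x x', ∑ y, conj (K x y) * K x' y = if x = x' then (C : ℂ) else 0)
    (v : EuclideanSpace ℂ X) : ‖kernelMap K v‖ ^ 2 = C * ‖v‖ ^ 2 := by
  have h1 : inner ℂ (kernelMap K v) (kernelMap K v) = (C : ℂ) * inner ℂ v v := by
    simp only [PiLp.inner_apply, RCLike.inner_apply, kernelMap_apply, map_sum, map_mul]
    calc ∑ y, (∑ x', K x' y * v x') * ∑ x, conj (K x y) * conj (v x)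
        = ∑ y, ∑ x, ∑ x', conj (K x y) * K x' y * (v x' * conj (v x)) := by
          refine Finset.sum_congr rfl fun y _ => ?_
          rw [mul_comm, Finset.sum_mul_sum]
          refine Finset.sum_congr rfl fun _ _ => Finset.sum_congr rfl fun _ _ => ?_
          ring
      _ = ∑ x, ∑ x', (∑ y, conj (K x y) * K x' y) * (v x' * conj (v x)) := by
          rw [Finset.sum_comm]
          refine Finset.sum_congr rfl fun _ _ => ?_
          rw [Finset.sum_comm]
          exact Finset.sum_congr rfl fun _ _ => (Finset.sum_mul ..).symm
      _ = _ := by simp [h, Finset.mul_sum]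
  rw [inner_self_eq_norm_sq_to_K, inner_self_eq_norm_sq_to_K,
    RCLike.ofReal_eq_complex_ofReal] at h1
  exact_mod_cast h1

end Gram

/-- The contraction over `z` of a tensor `k`, with legs `u` and `z`, and a tensor `a` that is
proportional to an isometry from `z` to `v`: the Gram sums of `k` are multiplied by a constant. In
the Gram sum of the contraction, `k` and `k'` are the tensor of the part already contracted, at two
values of its inputs, and likewise `a` and `a'`. -/
theorem sum_gram_contract {U V Z : Type*} [Fintype U] [Fintype V] [Fintype Z] [DecidableEq Z]
    (a a' : Z → V → ℂ) (k k' : U → Z → ℂ) (B : ℂ)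
    (h : ∀ z z', ∑ v, starRingEnd ℂ (a z v) * a' z' v = if z = z' then B else 0) :
    ∑ u, ∑ v, starRingEnd ℂ (∑ z, a z v * k u z) * ∑ z, a' z v * k' u z =
      B * ∑ u, ∑ z, starRingEnd ℂ (k u z) * k' u z := by
  rw [Finset.mul_sum]
  refine Finset.sum_congr rfl fun u _ => ?_
  calc _ = ∑ v, ∑ z, ∑ z', (starRingEnd ℂ (a z v) * a' z' v) *
        (starRingEnd ℂ (k u z) * k' u z') := by
        refine Finset.sum_congr rfl fun v _ => ?_
        rw [map_sum, Finset.sum_mul_sum]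
        refine Finset.sum_congr rfl fun _ _ => Finset.sum_congr rfl fun _ _ => ?_
        rw [map_mul]
        ring
    _ = ∑ z, ∑ z', (∑ v, starRingEnd ℂ (a z v) * a' z' v) *
        (starRingEnd ℂ (k u z) * k' u z') := by
        rw [Finset.sum_comm]
        refine Finset.sum_congr rfl fun _ _ => ?_
        rw [Finset.sum_comm]
        exact Finset.sum_congr rfl fun _ _ => (Finset.sum_mul ..).symm
    _ = _ := by simp [h, Finset.mul_sum]

/-- A perfect tensor has orthogonal columns of equal norm, as a matrix from at most half of its legs
to the others. -/
theorem IsPerfectTensor.exists_gram {L : Type} [Fintype L] [DecidableEq L] {d : ℕ}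
    {T : (L → Fin d) → ℂ} (hT : IsPerfectTensor T) {A : Finset L} (hA : A.card ≤ (Aᶜ).card) :
    ∃ C : ℝ, 0 < C ∧ ∀ a a' : A → Fin d,
      ∑ b, starRingEnd ℂ (T (glueLegs A a b)) * T (glueLegs A a' b) =
        if a = a' then (C : ℂ) else 0 := by
  obtain ⟨c, hc, h⟩ := hT A hA
  exact ⟨c ^ 2, by positivity, gram_of_norm_kernelMap (fun a b => T (glueLegs A a b)) c h⟩

/-! ### Sums over the values of finitely many variables -/

section SumUpdate

variable {L α R : Type*} [DecidableEq L]

open Function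

theorem updateFinset_of_mem {s : Finset L} (c : L → α) (w : s → α) {e : L} (h : e ∈ s) :
    updateFinset c s w e = w ⟨e, h⟩ := dif_pos h

theorem updateFinset_of_notMem {s : Finset L} (c : L → α) (w : s → α) {e : L} (h : e ∉ s) :
    updateFinset c s w e = c e := dif_neg h

theorem updateFinset_drop_middle {s t r : Finset L} (c : L → α) (u : s → α) (v : t → α)
    (z : r → α) {e : L} (ht : e ∉ t) :
    updateFinset (updateFinset (updateFinset c s u) t v) r z e =
      updateFinset (updateFinset c s u) r z e := by
  simp [updateFinset, ht]

theorem updateFinset_drop_left_comm {s t r : Finset L} (c : L → α) (u : s → α) (v : t → α)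
    (z : r → α) {e : L} (hs : e ∉ s) (hr : e ∈ r → e ∉ t) :
    updateFinset (updateFinset (updateFinset c s u) t v) r z e =
      updateFinset (updateFinset c r z) t v e := by
  by_cases her : e ∈ r
  · simp [updateFinset, her, hr her]
  · simp [updateFinset, her, hs]

theorem sum_updateFinset_union [Fintype α] [AddCommMonoid R] {s t : Finset L} (h : Disjoint s t)
    (F : ((L → α) → (L → α)) → R) :
    ∑ w : ↥(s ∪ t) → α, F (fun c => updateFinset c (s ∪ t) w) =
      ∑ u : s → α, ∑ v : t → α, F (fun c => updateFinset (updateFinset c s u) t v) := by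
  rw [← Fintype.sum_prod_type']
  refine (Fintype.sum_equiv (Equiv.piFinsetUnion (fun _ => α) h) _ _ fun uv => ?_).symm
  simp only [updateFinset_updateFinset h]

end SumUpdate

/-! ### The contraction of a network as a sum over edge values -/

section Amplitude

open Function ComplexConjugate

variable {p q : ℕ} {d : ℕ}

/-- The values on the legs of the chamber `g`, given values `x` on all bulk legs and `c` on all
pairs of chambers. -/
def legVals (x : BourdonGroup p q × Fin (q - 1) → Fin d) (c : Sym2 (BourdonGroup p q) → Fin d)
    (g : BourdonGroup p q) : Leg g → Fin d :=
  Sum.elim (fun h => c s(g, h.1)) (fun a => x (g, a))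

theorem legVals_congr {x : BourdonGroup p q × Fin (q - 1) → Fin d}
    {c c' : Sym2 (BourdonGroup p q) → Fin d} {g : BourdonGroup p q}
    (h : ∀ k, (chamberGraph p q).Adj g k → c s(g, k) = c' s(g, k)) :
    legVals x c g = legVals x c' g := by
  funext l
  rcases l with k | a
  · exact h k.1 k.2
  · rfl

open Classical in
/-- The pairs of adjacent chambers of `S`. -/
noncomputable def innerEdges (S : Finset (BourdonGroup p q)) : Finset (Sym2 (BourdonGroup p q)) :=
  S.sym2.filter (· ∈ (chamberGraph p q).edgeSet)

open Classical in
/-- The pairs of adjacent chambers with one chamber in `S` and the other in `S'`. -/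
noncomputable def crossEdges (S S' : Finset (BourdonGroup p q)) :
    Finset (Sym2 (BourdonGroup p q)) :=
  ((S ×ˢ S').filter fun e => (chamberGraph p q).Adj e.1 e.2).image fun e => s(e.1, e.2)

theorem mem_innerEdges {S : Finset (BourdonGroup p q)} {a b : BourdonGroup p q} :
    s(a, b) ∈ innerEdges S ↔ (chamberGraph p q).Adj a b ∧ a ∈ S ∧ b ∈ S := by
  simp [innerEdges, and_comm]

theorem mem_crossEdges {S S' : Finset (BourdonGroup p q)} {a b : BourdonGroup p q} :
    s(a, b) ∈ crossEdges S S' ↔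
      (chamberGraph p q).Adj a b ∧ (a ∈ S ∧ b ∈ S' ∨ b ∈ S ∧ a ∈ S') := by
  simp only [crossEdges, Finset.mem_image, Finset.mem_filter, Finset.mem_product, Prod.exists,
    Sym2.eq_iff]
  constructor
  · rintro ⟨k, l, ⟨⟨hk, hl⟩, hadj⟩, ⟨rfl, rfl⟩ | ⟨rfl, rfl⟩⟩
    · exact ⟨hadj, Or.inl ⟨hk, hl⟩⟩
    · exact ⟨hadj.symm, Or.inr ⟨hk, hl⟩⟩
  · rintro ⟨hadj, ⟨h1, h2⟩ | ⟨h1, h2⟩⟩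
    · exact ⟨a, b, ⟨⟨h1, h2⟩, hadj⟩, Or.inl ⟨rfl, rfl⟩⟩
    · exact ⟨b, a, ⟨⟨h1, h2⟩, hadj.symm⟩, Or.inr ⟨rfl, rfl⟩⟩

theorem mem_crossEdges_singleton {D : Finset (BourdonGroup p q)} {g a b : BourdonGroup p q} :
    s(a, b) ∈ crossEdges {g} D ↔
    (chamberGraph p q).Adj a b ∧ (a = g ∧ b ∈ D ∨ b = g ∧ a ∈ D) := by
  rw [mem_crossEdges, Finset.mem_singleton, Finset.mem_singleton]

/-- The component of the contracted tensor of `S` at the values `x` of the bulk legs and `c` of the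
edges that leave `S`; the values of `x` and `c` elsewhere have no influence. -/
noncomputable def amplitude (T : ∀ g : BourdonGroup p q, (Leg g → Fin d) → ℂ)
    (S : Finset (BourdonGroup p q)) (x : BourdonGroup p q × Fin (q - 1) → Fin d)
    (c : Sym2 (BourdonGroup p q) → Fin d) : ℂ :=
  ∑ w : innerEdges S → Fin d, ∏ g ∈ S, T g (legVals x (updateFinset c (innerEdges S) w) g)

theorem amplitude_singleton (T : ∀ g : BourdonGroup p q, (Leg g → Fin d) → ℂ)
    (g : BourdonGroup p q) (x : BourdonGroup p q × Fin (q - 1) → Fin d)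
    (c : Sym2 (BourdonGroup p q) → Fin d) : amplitude T {g} x c = T g (legVals x c g) := by
  have h : innerEdges {g} = (∅ : Finset (Sym2 (BourdonGroup p q))) := by
    ext e
    induction e with
    | _ a b =>
      simp only [mem_innerEdges, Finset.mem_singleton, Finset.notMem_empty, iff_false]
      rintro ⟨hadj, rfl, rfl⟩
      exact hadj.ne rfl
  rw [amplitude, h]
  simp

/-- Contracting two disjoint parts of the network, and then the edges between them. -/
theorem amplitude_union (T : ∀ g : BourdonGroup p q, (Leg g → Fin d) → ℂ)
    {S S' : Finset (BourdonGroup p q)} (hS : Disjoint S S')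
    (x : BourdonGroup p q × Fin (q - 1) → Fin d) (c : Sym2 (BourdonGroup p q) → Fin d) :
    amplitude T (S ∪ S') x c = ∑ z : crossEdges S S' → Fin d,
      amplitude T S x (updateFinset c _ z) * amplitude T S' x (updateFinset c _ z) := by
  have hS' : ∀ {a}, a ∈ S → a ∉ S' := fun h h' => Finset.disjoint_left.mp hS h h'
  have h0 : innerEdges (S ∪ S') = crossEdges S S' ∪ (innerEdges S ∪ innerEdges S') := by
    ext e
    induction e with
    | _ a b =>
      simp only [Finset.mem_union, mem_innerEdges, mem_crossEdges]
      tauto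
  have h1 : Disjoint (innerEdges S) (innerEdges S') := by
    rw [Finset.disjoint_left]
    intro e
    induction e with
    | _ a b =>
      simp only [mem_innerEdges]
      exact fun h h' => hS' h.2.1 h'.2.1
  have h2 : Disjoint (crossEdges S S') (innerEdges S ∪ innerEdges S') := by
    rw [Finset.disjoint_left]
    intro e
    induction e with
    | _ a b =>
      simp only [Finset.mem_union, mem_innerEdges, mem_crossEdges]
      have := @hS' a
      have := @hS' b
      tauto
  rw [amplitude, h0, sum_updateFinset_union h2
    fun u => ∏ g ∈ S ∪ S', T g (legVals x (u c) g)]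
  refine Finset.sum_congr rfl fun z _ => ?_
  rw [sum_updateFinset_union h1
    fun u => ∏ g ∈ S ∪ S', T g (legVals x (u (updateFinset c (crossEdges S S') z)) g),
    amplitude, amplitude, Finset.sum_mul_sum]
  refine Finset.sum_congr rfl fun w _ => Finset.sum_congr rfl fun w' _ => ?_
  rw [Finset.prod_union hS]
  congr 1
  · refine Finset.prod_congr rfl fun g hg => congrArg _ (legVals_congr fun k _ => ?_)
    exact updateFinset_of_notMem _ _ fun h => hS' hg (mem_innerEdges.mp h).2.1
  · refine Finset.prod_congr rfl fun g hg => congrArg _ (legVals_congr fun k _ => ?_)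
    have hn : s(g, k) ∉ innerEdges S := fun h => hS' (mem_innerEdges.mp h).2.1 hg
    simp only [updateFinset, dif_neg hn]

theorem contractedTensor_eq_amplitude (T : ∀ g : BourdonGroup p q, (Leg g → Fin d) → ℂ)
    (S : Finset (BourdonGroup p q)) (x : BourdonGroup p q × Fin (q - 1) → Fin d)
    (c : Sym2 (BourdonGroup p q) → Fin d) {x' : BulkLeg S → Fin d} {y' : OuterLeg S → Fin d}
    (hx : ∀ k, x' k = x (k.1.1, k.2)) (hy : ∀ e, y' e = c s(e.1.1, e.1.2)) :
    contractedTensor T S x' y' = amplitude T S x c := by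
  unfold contractedTensor amplitude
  let e : InnerLeg S ≃ innerEdges S := Equiv.subtypeEquivRight fun e => by
    simp [innerEdges, Finset.mem_sym2_iff, and_comm]
  refine Fintype.sum_equiv (e.arrowCongr (Equiv.refl _)) _ _ fun z => ?_
  refine Eq.trans ?_ (Finset.prod_coe_sort S fun g =>
    T g (legVals x (updateFinset c (innerEdges S) (e.arrowCongr (Equiv.refl _) z)) g))
  refine Finset.prod_congr rfl fun g _ => congrArg _ (funext fun l => ?_)
  rcases l with k | a
  · by_cases hk : k.1 ∈ S
    · have hmem : s(g.1, k.1) ∈ innerEdges S := mem_innerEdges.mpr ⟨k.2, g.2, hk⟩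
      simp only [legValues, hk, dite_true, legVals, Sum.elim_inl]
      rw [updateFinset_of_mem _ _ hmem]
      rfl
    · have hmem : s(g.1, k.1) ∉ innerEdges S := fun h => hk (mem_innerEdges.mp h).2.2
      simp only [legValues, hk, dite_false, legVals, Sum.elim_inl]
      rw [updateFinset_of_notMem _ _ hmem, hy]
  · exact hx (g, a)

variable [NeZero p] [NeZero q]

open Classical in
/-- The pairs of adjacent chambers with exactly one chamber in `S`. -/
noncomputable def cutEdges (S : Finset (BourdonGroup p q)) : Finset (Sym2 (BourdonGroup p q)) :=
  Finset.univ.image fun e : OuterLeg S => s(e.1.1, e.1.2)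

theorem mem_cutEdges {S : Finset (BourdonGroup p q)} {a b : BourdonGroup p q} :
    s(a, b) ∈ cutEdges S ↔
      (chamberGraph p q).Adj a b ∧ (a ∈ S ∧ b ∉ S ∨ b ∈ S ∧ a ∉ S) := by
  simp only [cutEdges, Finset.mem_image, Finset.mem_univ, true_and, Subtype.exists, Prod.exists,
    Sym2.eq_iff]
  constructor
  · rintro ⟨k, l, ⟨hk, hl, hadj⟩, ⟨rfl, rfl⟩ | ⟨rfl, rfl⟩⟩
    · exact ⟨hadj, Or.inl ⟨hk, hl⟩⟩
    · exact ⟨hadj.symm, Or.inr ⟨hk, hl⟩⟩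
  · rintro ⟨hadj, ⟨h1, h2⟩ | ⟨h1, h2⟩⟩
    · exact ⟨a, b, ⟨h1, h2, hadj⟩, Or.inl ⟨rfl, rfl⟩⟩
    · exact ⟨b, a, ⟨h1, h2, hadj.symm⟩, Or.inr ⟨rfl, rfl⟩⟩

/-- The cut legs of `S` correspond to its cut edges. -/
noncomputable def outerLegEquiv (S : Finset (BourdonGroup p q)) : OuterLeg S ≃ cutEdges S :=
  Equiv.ofBijective
    (fun e => ⟨s(e.1.1, e.1.2), Finset.mem_image_of_mem _ (Finset.mem_univ e)⟩) <| by
    constructor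
    · rintro ⟨⟨a, b⟩, ha, hb, hab⟩ ⟨⟨a', b'⟩, ha', hb', hab'⟩ h
      rcases Sym2.eq_iff.mp (Subtype.ext_iff.mp h) with ⟨h1, h2⟩ | ⟨h1, h2⟩
      · exact Subtype.ext (Prod.ext h1 h2)
      · simp only at ha hb' h1
        exact absurd (h1 ▸ ha) hb'
    · rintro ⟨e, he⟩
      obtain ⟨l, -, rfl⟩ := Finset.mem_image.mp he
      exact ⟨l, rfl⟩

theorem amplitude_congr (T : ∀ g : BourdonGroup p q, (Leg g → Fin d) → ℂ)
    (S : Finset (BourdonGroup p q)) (x : BourdonGroup p q × Fin (q - 1) → Fin d)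
    {c c' : Sym2 (BourdonGroup p q) → Fin d} (h : ∀ e ∈ cutEdges S, c e = c' e) :
    amplitude T S x c = amplitude T S x c' := by
  rw [← contractedTensor_eq_amplitude T S x c (fun _ => rfl) (fun _ => rfl)]
  exact contractedTensor_eq_amplitude T S x c' (fun _ => rfl)
    fun e => h _ (outerLegEquiv S e).2

end Amplitude

/-! ### Networks of perfect tensors are isometries -/

section NetworkGram

open Function ComplexConjugate

variable {p q : ℕ} [NeZero p] [NeZero q] {d : ℕ}

open Classical in
/-- The perfect tensor of a chamber `g`, as a matrix from the bulk legs of `g` and its legs outside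
`O` to its legs in `O`, if the latter are at least half of all legs. -/
theorem exists_gram_vertex {T : ∀ g : BourdonGroup p q, (Leg g → Fin d) → ℂ}
    {g : BourdonGroup p q} (hT : IsPerfectTensor (T g)) {O : Finset (Sym2 (BourdonGroup p q))}
    (hO : ∀ e ∈ O, ∃ k, (chamberGraph p q).Adj g k ∧ e = s(g, k))
    (hcard : (Finset.univ.filter fun k : {k // (chamberGraph p q).Adj g k} =>
        s(g, k.1) ∉ O).card + (q - 1) ≤
      (Finset.univ.filter fun k : {k // (chamberGraph p q).Adj g k} => s(g, k.1) ∈ O).card) :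
    ∃ C : ℝ, 0 < C ∧ ∀ (x x' : BourdonGroup p q × Fin (q - 1) → Fin d)
      (c c' : Sym2 (BourdonGroup p q) → Fin d),
      ∑ w : O → Fin d, conj (T g (legVals x (updateFinset c O w) g)) *
        T g (legVals x' (updateFinset c' O w) g) =
      if (∀ a, x (g, a) = x' (g, a)) ∧
        ∀ k, (chamberGraph p q).Adj g k → s(g, k) ∉ O → c s(g, k) = c' s(g, k)
      then (C : ℂ) else 0 := by
  -- The input legs of the tensor, for which `IsPerfectTensor` is applied.
  set A : Finset (Leg g) := (Finset.univ.filter fun k : {k // (chamberGraph p q).Adj g k} =>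
    s(g, k.1) ∉ O).disjSum Finset.univ with hA
  have hAl : ∀ k, Sum.inl k ∈ A ↔ s(g, k.1) ∉ O := fun k => by simp [hA]
  have hAr : ∀ a, Sum.inr a ∈ A := fun a => by simp [hA]
  have hAc : Aᶜ = (Finset.univ.filter fun k : {k // (chamberGraph p q).Adj g k} =>
      s(g, k.1) ∈ O).disjSum ∅ := by
    ext l
    rcases l with k | a
    · simp [hAl]
    · simp [hAr]
  have hAcard : A.card ≤ (Aᶜ).card := by
    rw [hAc, hA, Finset.card_disjSum, Finset.card_disjSum, Finset.card_univ, Fintype.card_fin]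
    simpa using hcard
  obtain ⟨C, hC, h⟩ := hT.exists_gram hAcard
  refine ⟨C, hC, fun x x' c c' => ?_⟩
  choose k hadj hk using fun e : O => hO e.1 e.2
  have hmem : ∀ e, Sum.inl ⟨k e, hadj e⟩ ∈ Aᶜ := fun e => by
    rw [Finset.mem_compl, hAl, not_not, ← hk]
    exact e.2
  let f : O ≃ ↥(Aᶜ) := Equiv.ofBijective (fun e => ⟨Sum.inl ⟨k e, hadj e⟩, hmem e⟩) <| by
    constructor
    · intro e e' he
      have h1 : k e = k e' := congrArg Subtype.val (Sum.inl.inj (Subtype.ext_iff.mp he))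
      exact Subtype.ext (by rw [hk, h1, ← hk])
    · rintro ⟨l, hl⟩
      rcases l with ⟨m, hm⟩ | a
      · have h1 : s(g, m) ∈ O := by
          simpa [hAl] using hl
        have h2 := hk ⟨s(g, m), h1⟩
        refine ⟨⟨s(g, m), h1⟩, Subtype.ext (congrArg Sum.inl (Subtype.ext ?_))⟩
        exact (Sym2.congr_right.mp h2).symm
      · exact absurd (hAr a) (Finset.mem_compl.mp hl)
  have hglue : ∀ (x : BourdonGroup p q × Fin (q - 1) → Fin d)
      (c : Sym2 (BourdonGroup p q) → Fin d) (w : O → Fin d),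
      legVals x (updateFinset c O w) g =
        glueLegs A (fun l => legVals x c g l) (f.arrowCongr (Equiv.refl _) w) := by
    intro x c w
    funext l
    rcases l with m | a
    · by_cases hm : s(g, m.1) ∈ O
      · have hmA : Sum.inl m ∉ A := fun h => (hAl m).mp h hm
        have hf : f.symm ⟨Sum.inl m, Finset.mem_compl.mpr hmA⟩ = ⟨s(g, m.1), hm⟩ := by
          rw [Equiv.symm_apply_eq]
          exact Subtype.ext (congrArg Sum.inl (Subtype.ext
            (Sym2.congr_right.mp (hk ⟨s(g, m.1), hm⟩))))
        simp only [glueLegs, hmA, dite_false, legVals, Sum.elim_inl]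
        rw [updateFinset_of_mem _ _ hm]
        simp [hf]
      · simp only [glueLegs, (hAl m).mpr hm, dite_true, legVals, Sum.elim_inl]
        rw [updateFinset_of_notMem _ _ hm]
    · simp only [glueLegs, hAr a, dite_true, legVals, Sum.elim_inr]
  have hiff : (fun l : A => legVals x c g l) = (fun l : A => legVals x' c' g l) ↔
      (∀ a, x (g, a) = x' (g, a)) ∧
        ∀ k, (chamberGraph p q).Adj g k → s(g, k) ∉ O → c s(g, k) = c' s(g, k) := by
    refine ⟨fun h => ⟨fun a => congrFun h ⟨Sum.inr a, hAr a⟩, fun k hk hkO =>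
      congrFun h ⟨Sum.inl ⟨k, hk⟩, (hAl _).mpr hkO⟩⟩, fun h => funext ?_⟩
    rintro ⟨m | a, hl⟩
    · exact h.2 m.1 m.2 ((hAl m).mp hl)
    · exact h.1 a
  rw [← if_congr hiff rfl rfl, ← h]
  refine Fintype.sum_equiv (f.arrowCongr (Equiv.refl _)) _ _ fun w => ?_
  rw [hglue, hglue]

/-- The cut edges of `D` that do not lead to `S₀`. -/
noncomputable def outEdges (S₀ D : Finset (BourdonGroup p q)) :
    Finset (Sym2 (BourdonGroup p q)) := cutEdges D \ crossEdges S₀ D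

theorem mem_outEdges {S₀ D : Finset (BourdonGroup p q)} (hD : Disjoint S₀ D)
    {a b : BourdonGroup p q} : s(a, b) ∈ outEdges S₀ D ↔ (chamberGraph p q).Adj a b ∧
      (a ∈ D ∧ b ∉ D ∧ b ∉ S₀ ∨ b ∈ D ∧ a ∉ D ∧ a ∉ S₀) := by
  have ha : a ∈ S₀ → a ∉ D := fun h => Finset.disjoint_left.mp hD h
  have hb : b ∈ S₀ → b ∉ D := fun h => Finset.disjoint_left.mp hD h
  simp only [outEdges, Finset.mem_sdiff, mem_cutEdges, mem_crossEdges]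
  grind

section Attach

variable {S₀ D : Finset (BourdonGroup p q)} {g : BourdonGroup p q}

theorem mem_outEdges_insert_left (hD : Disjoint S₀ D) (hgD : g ∉ D) {a b : BourdonGroup p q} :
    s(a, b) ∈ outEdges (insert g S₀) D ↔ (chamberGraph p q).Adj a b ∧
      (a ∈ D ∧ b ∉ D ∧ b ∉ S₀ ∧ b ≠ g ∨ b ∈ D ∧ a ∉ D ∧ a ∉ S₀ ∧ a ≠ g) := by
  rw [mem_outEdges (Finset.disjoint_insert_left.mpr ⟨hgD, hD⟩)]
  simp only [Finset.mem_insert]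
  grind

theorem mem_outEdges_singleton (hgS : g ∉ S₀) (hgD : g ∉ D) {k : BourdonGroup p q} :
    s(g, k) ∈ outEdges (S₀ ∪ D) {g} ↔ (chamberGraph p q).Adj g k ∧ k ∉ S₀ ∧ k ∉ D := by
  rw [mem_outEdges (by simp [hgS, hgD])]
  simp only [Finset.mem_singleton, Finset.mem_union]
  have := fun h : (chamberGraph p q).Adj g k => h.ne'
  grind

theorem exists_of_mem_outEdges_singleton (hgS : g ∉ S₀) (hgD : g ∉ D) {e : Sym2 (BourdonGroup p q)}
    (he : e ∈ outEdges (S₀ ∪ D) {g}) : ∃ k, (chamberGraph p q).Adj g k ∧ e = s(g, k) := by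
  induction e with
  | _ a b =>
    rw [mem_outEdges (by simp [hgS, hgD]), Finset.mem_singleton, Finset.mem_singleton] at he
    obtain ⟨h, ⟨rfl, -⟩ | ⟨rfl, -⟩⟩ := he
    · exact ⟨b, h, rfl⟩
    · exact ⟨a, h.symm, Sym2.eq_swap⟩

theorem outEdges_insert (hD : Disjoint S₀ D) (hgS : g ∉ S₀) (hgD : g ∉ D) :
    outEdges S₀ (insert g D) = outEdges (insert g S₀) D ∪ outEdges (S₀ ∪ D) {g} := by
  ext e
  induction e with
  | _ a b =>
    have := fun h : (chamberGraph p q).Adj a b => h.ne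
    rw [Finset.mem_union, mem_outEdges_insert_left hD hgD,
      mem_outEdges (Finset.disjoint_insert_right.mpr ⟨hgS, hD⟩), mem_outEdges (by simp [hgS, hgD])]
    simp only [Finset.mem_insert, Finset.mem_singleton, Finset.mem_union]
    grind

theorem disjoint_outEdges (hD : Disjoint S₀ D) (hgS : g ∉ S₀) (hgD : g ∉ D) :
    Disjoint (outEdges (insert g S₀) D) (outEdges (S₀ ∪ D) {g}) := by
  rw [Finset.disjoint_right]
  intro e he
  obtain ⟨k, hk, rfl⟩ := exists_of_mem_outEdges_singleton hgS hgD he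
  rw [mem_outEdges_insert_left hD hgD]
  grind

theorem outEdges_eq_union_crossEdges (hD : Disjoint S₀ D) (hgS : g ∉ S₀) (hgD : g ∉ D) :
    outEdges S₀ D = outEdges (insert g S₀) D ∪ crossEdges {g} D := by
  ext e
  induction e with
  | _ a b =>
    rw [Finset.mem_union, mem_outEdges_insert_left hD hgD, mem_outEdges hD,
      mem_crossEdges_singleton]
    grind

theorem disjoint_outEdges_crossEdges (hD : Disjoint S₀ D) (hgD : g ∉ D) :
    Disjoint (outEdges (insert g S₀) D) (crossEdges {g} D) := by
  rw [Finset.disjoint_left]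
  intro e
  induction e with
  | _ a b =>
    rw [mem_outEdges_insert_left hD hgD, mem_crossEdges_singleton]
    grind

/-- The contraction of the network on `D ∪ {g}` in terms of its parts. The legs of `g` are not
among the remaining outgoing edges of `D`, and the new outgoing edges are not legs of `D`. -/
theorem amplitude_insert (hD : Disjoint S₀ D) (hgS : g ∉ S₀) (hgD : g ∉ D)
    (T : ∀ g : BourdonGroup p q, (Leg g → Fin d) → ℂ)
    (x : BourdonGroup p q × Fin (q - 1) → Fin d) (c : Sym2 (BourdonGroup p q) → Fin d)
    (u : outEdges (insert g S₀) D → Fin d) (v : outEdges (S₀ ∪ D) {g} → Fin d) :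
    amplitude T (insert g D) x (updateFinset (updateFinset c _ u) _ v) =
      ∑ z : crossEdges {g} D → Fin d,
        T g (legVals x (updateFinset (updateFinset c _ z) _ v) g) *
          amplitude T D x (updateFinset (updateFinset c _ u) _ z) := by
  rw [Finset.insert_eq g D, amplitude_union T (Finset.disjoint_singleton_left.mpr hgD)]
  refine Finset.sum_congr rfl fun z _ => ?_
  rw [amplitude_singleton]
  refine congrArg₂ (· * ·) (congrArg (T g) (legVals_congr fun k hk => ?_))
    (amplitude_congr T D x fun e he => ?_)
  · have h1 : s(g, k) ∉ outEdges (insert g S₀) D := by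
      rw [mem_outEdges_insert_left hD hgD]
      grind
    have h2 : s(g, k) ∈ crossEdges {g} D → s(g, k) ∉ outEdges (S₀ ∪ D) {g} := by
      rw [mem_crossEdges_singleton, mem_outEdges_singleton hgS hgD]
      have := hk.ne'
      grind
    exact updateFinset_drop_left_comm c u v z h1 h2
  · have h1 : e ∉ outEdges (S₀ ∪ D) {g} := by
      intro h
      obtain ⟨k, hk, rfl⟩ := exists_of_mem_outEdges_singleton hgS hgD h
      rw [mem_cutEdges] at he
      rw [mem_outEdges_singleton hgS hgD] at h
      grind
    exact updateFinset_drop_middle c u v z h1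

/-- Two settings of the input legs of `g` agree if and only if they agree on the legs to `D` and on
the legs to `S₀`. -/
theorem input_eq_iff (hD : Disjoint S₀ D) (hgS : g ∉ S₀) (hgD : g ∉ D)
    (c c' : Sym2 (BourdonGroup p q) → Fin d) (z z' : crossEdges {g} D → Fin d) :
    (∀ k, (chamberGraph p q).Adj g k → s(g, k) ∉ outEdges (S₀ ∪ D) {g} →
      updateFinset c _ z s(g, k) = updateFinset c' _ z' s(g, k)) ↔
    z = z' ∧ ∀ e ∈ crossEdges S₀ {g}, c e = c' e := by
  constructor
  · intro h2
    refine ⟨funext ?_, fun e => ?_⟩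
    · rintro ⟨e, he⟩
      have key : ∀ k (hk : s(g, k) ∈ crossEdges {g} D),
          z ⟨s(g, k), hk⟩ = z' ⟨s(g, k), hk⟩ := by
        intro k hk
        have hk' := mem_crossEdges_singleton.mp hk
        have h3 := h2 k hk'.1 (by
          rw [mem_outEdges_singleton hgS hgD]
          have := hk'.1.ne'
          grind)
        rwa [updateFinset_of_mem _ _ hk, updateFinset_of_mem _ _ hk] at h3
      induction e with
      | _ a b =>
        rcases (mem_crossEdges_singleton.mp he).2 with ⟨rfl, -⟩ | ⟨rfl, -⟩
        · exact key _ he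
        · have h3 := key a (by rwa [Sym2.eq_swap])
          simpa only [Sym2.eq_swap (a := a)] using h3
    · have key : ∀ k, (chamberGraph p q).Adj g k → k ∈ S₀ → c s(g, k) = c' s(g, k) := by
        intro k hk hk0
        have hkD : k ∉ D := Finset.disjoint_left.mp hD hk0
        have hkX : s(g, k) ∉ crossEdges {g} D := by
          rw [mem_crossEdges_singleton]
          have := hk.ne'
          grind
        have h3 := h2 k hk (by
          rw [mem_outEdges_singleton hgS hgD]
          grind)
        rwa [updateFinset_of_notMem _ _ hkX, updateFinset_of_notMem _ _ hkX] at h3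
      induction e with
      | _ a b =>
        rw [mem_crossEdges, Finset.mem_singleton, Finset.mem_singleton]
        rintro ⟨h, ⟨ha, rfl⟩ | ⟨hb, rfl⟩⟩
        · rw [Sym2.eq_swap]
          exact key a h.symm ha
        · exact key b h hb
  · rintro ⟨rfl, h2⟩ k hk hkO
    by_cases hkX : s(g, k) ∈ crossEdges {g} D
    · rw [updateFinset_of_mem _ _ hkX, updateFinset_of_mem _ _ hkX]
    · rw [updateFinset_of_notMem _ _ hkX, updateFinset_of_notMem _ _ hkX]
      refine h2 _ (mem_crossEdges.mpr ⟨hk, ?_⟩)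
      rw [mem_outEdges_singleton hgS hgD] at hkO
      rw [mem_crossEdges_singleton] at hkX
      rw [Finset.mem_singleton, Finset.mem_singleton]
      grind

end Attach

open Classical in
/-- The part of the network on `D`, whose chambers are at least as far from `o` as those of `S₀`,
is proportional to an isometry from its bulk legs and its legs to `S₀` to all its other cut legs:
the columns of its matrix are orthogonal and have equal norms. The chambers of `D` are attached in
order of their height: when `g` is attached, its legs to the chambers already present lead to
chambers that are not higher. -/
theorem exists_gram_amplitude (hp : 5 ≤ p) {T : ∀ g : BourdonGroup p q, (Leg g → Fin d) → ℂ}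
    (hT : ∀ g, IsPerfectTensor (T g)) (o : BourdonGroup p q) (S₀ D : Finset (BourdonGroup p q))
    (hdisj : Disjoint S₀ D) (hheight : ∀ g ∈ D, ∀ h ∈ S₀, height o h ≤ height o g) :
    ∃ C : ℝ, 0 < C ∧ ∀ (x x' : BourdonGroup p q × Fin (q - 1) → Fin d)
      (c c' : Sym2 (BourdonGroup p q) → Fin d),
      ∑ w : ↥(outEdges S₀ D) → Fin d, conj (amplitude T D x (updateFinset c _ w)) *
        amplitude T D x' (updateFinset c' _ w) =
      if (∀ g ∈ D, ∀ a, x (g, a) = x' (g, a)) ∧ ∀ e ∈ crossEdges S₀ D, c e = c' e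
      then (C : ℂ) else 0 := by
  induction D using Finset.induction_on_max_value (height o) with
  | empty =>
    have h1 : cutEdges (∅ : Finset (BourdonGroup p q)) = ∅ := by
      ext e
      induction e with
      | _ a b => simp [mem_cutEdges]
    have h2 : crossEdges S₀ (∅ : Finset (BourdonGroup p q)) = ∅ := by simp [crossEdges]
    have h3 : innerEdges (∅ : Finset (BourdonGroup p q)) = ∅ := by simp [innerEdges]
    refine ⟨1, one_pos, fun x x' c c' => ?_⟩
    rw [outEdges, h1, h2]
    simp [amplitude, h3]
  | insert g D hgD hmax ih =>
    obtain ⟨hg0, hD0⟩ : g ∉ S₀ ∧ Disjoint S₀ D := by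
      rwa [Finset.disjoint_insert_right] at hdisj
    obtain ⟨C, hC, hgram⟩ := ih hD0 fun g hg => hheight g (Finset.mem_insert_of_mem hg)
    obtain ⟨C', hC', hvertex⟩ := exists_gram_vertex (hT g) (O := outEdges (S₀ ∪ D) {g})
      (fun e => exists_of_mem_outEdges_singleton hg0 hgD)
      (by
        refine le_trans (Nat.add_le_add_right (Finset.card_le_card ?_) _)
          ((card_legs_le hp o g).trans (Finset.card_le_card ?_))
        · intro k hk
          simp only [Finset.mem_filter, Finset.mem_univ, true_and,
            mem_outEdges_singleton hg0 hgD] at hk ⊢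
          by_cases hkD : k.1 ∈ D
          · exact hmax _ hkD
          · by_contra hlt
            exact hk ⟨k.2, fun h0 => hlt (hheight g (Finset.mem_insert_self g D) _ h0), hkD⟩
        · intro k hk
          simp only [Finset.mem_filter, Finset.mem_univ, true_and,
            mem_outEdges_singleton hg0 hgD] at hk ⊢
          exact ⟨k.2, fun h => (hheight g (Finset.mem_insert_self g D) _ h).not_gt hk,
            fun h => (hmax _ h).not_gt hk⟩)
    refine ⟨C' * C, mul_pos hC' hC, fun x x' c c' => ?_⟩
    -- The free legs are the remaining ones of `D` and the new ones of `g`; only the tensor of `g`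
    -- depends on the latter. Summing over them first identifies the two settings of the legs from
    -- `g` to `D`, and leaves the Gram sum of `D`.
    rw [outEdges_insert hD0 hg0 hgD, sum_updateFinset_union (disjoint_outEdges hD0 hg0 hgD) fun u =>
      conj (amplitude T (insert g D) x (u c)) * amplitude T (insert g D) x' (u c')]
    have hgram' := hgram x x' c c'
    rw [outEdges_eq_union_crossEdges hD0 hg0 hgD,
      sum_updateFinset_union (disjoint_outEdges_crossEdges hD0 hgD) fun u =>
      conj (amplitude T D x (u c)) * amplitude T D x' (u c')] at hgram'
    simp only [amplitude_insert hD0 hg0 hgD]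
    rw [sum_gram_contract _ _ _ _
      (if (∀ a, x (g, a) = x' (g, a)) ∧ ∀ e ∈ crossEdges S₀ {g}, c e = c' e then (C' : ℂ) else 0)
      fun z z' => ?_]
    · rw [hgram', ite_zero_mul_ite_zero, ← Complex.ofReal_mul]
      refine if_congr ?_ rfl rfl
      have hcross : ∀ e, e ∈ crossEdges S₀ (insert g D) ↔
          e ∈ crossEdges S₀ {g} ∨ e ∈ crossEdges S₀ D := by
        intro e
        induction e with
        | _ a b =>
          simp only [mem_crossEdges, Finset.mem_insert, Finset.mem_singleton]
          grind
      simp only [hcross, Finset.forall_mem_insert, or_imp, forall_and]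
      grind
    · rw [hvertex, if_congr (and_congr_right' (input_eq_iff hD0 hg0 hgD c c' z z')) rfl rfl]
      split_ifs <;> grind

end NetworkGram

/-! ### The bulk-to-boundary maps and the layer maps -/

section Layers

open Function ComplexConjugate

variable {p q : ℕ} {d : ℕ}

/-- Values on the bulk legs of `S`, extended to all bulk legs by the constant `i`. -/
noncomputable def extendBulk (i : Fin d) {S : Finset (BourdonGroup p q)} (x : BulkLeg S → Fin d) :
    BourdonGroup p q × Fin (q - 1) → Fin d :=
  Function.extend (fun k => (k.1.1, k.2)) x fun _ => i

theorem extendBulk_apply (i : Fin d) {S : Finset (BourdonGroup p q)} (x : BulkLeg S → Fin d)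
    (k : BulkLeg S) : extendBulk i x (k.1.1, k.2) = x k :=
  Function.Injective.extend_apply (fun k l h => by
    simp only [Prod.mk.injEq] at h
    exact Prod.ext (Subtype.ext h.1) h.2) x _ k

theorem extendBulk_agree_iff (i : Fin d) {S : Finset (BourdonGroup p q)}
    (x x' : BulkLeg S → Fin d) :
    (∀ g ∈ S, ∀ a, extendBulk i x (g, a) = extendBulk i x' (g, a)) ↔ x = x' := by
  refine ⟨fun h => funext fun k => ?_, fun h => by simp [h]⟩
  have := h k.1.1 k.1.2 k.2
  rwa [extendBulk_apply, extendBulk_apply] at this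

variable [NeZero p] [NeZero q]

theorem sum_outerLeg_eq_sum_cutEdges {R : Type*} [AddCommMonoid R] (S : Finset (BourdonGroup p q))
    (F : (OuterLeg S → Fin d) → R) :
    ∑ y, F y = ∑ w : cutEdges S → Fin d, F fun e => w (outerLegEquiv S e) :=
  Fintype.sum_equiv ((outerLegEquiv S).arrowCongr (Equiv.refl _)) _ _ fun y => congrArg F <| by
    funext e
    simp

theorem updateFinset_outerLeg {S : Finset (BourdonGroup p q)}
    (c : Sym2 (BourdonGroup p q) → Fin d) (w : cutEdges S → Fin d) (e : OuterLeg S) :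
    updateFinset c _ w s(e.1.1, e.1.2) = w (outerLegEquiv S e) :=
  updateFinset_of_mem _ _ (outerLegEquiv S e).2

/-- Values on the cut legs of `S`, extended to all pairs of chambers by the constant `i`. -/
noncomputable def extendCut (i : Fin d) {S : Finset (BourdonGroup p q)} (y : OuterLeg S → Fin d) :
    Sym2 (BourdonGroup p q) → Fin d :=
  updateFinset (fun _ => i) (cutEdges S) fun e => y ((outerLegEquiv S).symm e)

theorem extendCut_apply (i : Fin d) {S : Finset (BourdonGroup p q)} (y : OuterLeg S → Fin d)
    (e : OuterLeg S) : extendCut i y s(e.1.1, e.1.2) = y e := by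
  rw [extendCut, updateFinset_outerLeg, Equiv.symm_apply_apply]

theorem contractedTensor_eq_extendBulk (T : ∀ g : BourdonGroup p q, (Leg g → Fin d) → ℂ)
    (i : Fin d) (S : Finset (BourdonGroup p q)) (c : Sym2 (BourdonGroup p q) → Fin d)
    (x : BulkLeg S → Fin d) (w : cutEdges S → Fin d) :
    contractedTensor T S x (fun e => w (outerLegEquiv S e)) =
      amplitude T S (extendBulk i x) (updateFinset c _ w) :=
  contractedTensor_eq_amplitude T S _ _ (fun k => (extendBulk_apply i x k).symm)
    fun e => (updateFinset_outerLeg c w e).symm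

theorem exists_norm_sq_networkMap (hp : 5 ≤ p) (i : Fin d)
    {T : ∀ g : BourdonGroup p q, (Leg g → Fin d) → ℂ}
    (hT : ∀ g, IsPerfectTensor (T g)) (o : BourdonGroup p q) (n : ℕ) :
    ∃ C : ℝ, 0 < C ∧ ∀ ψ, ‖networkMap T o n ψ‖ ^ 2 = C * ‖ψ‖ ^ 2 := by
  classical
  obtain ⟨C, hC, h⟩ := exists_gram_amplitude hp hT o ∅ (chamberBall o n)
    (Finset.disjoint_empty_left _) (by simp)
  refine ⟨C, hC, fun ψ => norm_sq_kernelMap_of_gram (fun x y =>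
    contractedTensor T (chamberBall o n) x y) C (fun x x' => ?_) ψ⟩
  have h1 : crossEdges ∅ (chamberBall o n) = ∅ := by simp [crossEdges]
  have h2 : outEdges ∅ (chamberBall o n) = cutEdges (chamberBall o n) := by
    rw [outEdges, h1, Finset.sdiff_empty]
  have h3 := h (extendBulk i x) (extendBulk i x') (fun _ => i) (fun _ => i)
  rw [h2, h1] at h3
  simp only [extendBulk_agree_iff, Finset.notMem_empty, implies_true, and_true] at h3
  rw [sum_outerLeg_eq_sum_cutEdges]
  simp only [contractedTensor_eq_extendBulk T i _ fun _ => i]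
  exact h3

theorem mem_nextLayer_iff {o g : BourdonGroup p q} {n : ℕ} :
    g ∈ nextLayer o n ↔ height o g = n + 1 := by
  rw [mem_nextLayer, mem_chamberBall, mem_chamberBall]
  omega

theorem chamberBall_union_nextLayer (o : BourdonGroup p q) (n : ℕ) :
    chamberBall o n ∪ nextLayer o n = chamberBall o (n + 1) :=
  Finset.union_sdiff_of_subset (chamberBall_subset_succ o n)

theorem disjoint_chamberBall_nextLayer (o : BourdonGroup p q) (n : ℕ) :
    Disjoint (chamberBall o n) (nextLayer o n) := Finset.disjoint_sdiff

theorem crossEdges_chamberBall_nextLayer (o : BourdonGroup p q) (n : ℕ) :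
    crossEdges (chamberBall o n) (nextLayer o n) = cutEdges (chamberBall o n) := by
  ext e
  induction e with
  | _ a b =>
    simp only [mem_crossEdges, mem_cutEdges, mem_nextLayer_iff, mem_chamberBall]
    refine and_congr_right fun h => ?_
    have h1 := height_le_of_adj o h
    have h2 := height_le_of_adj o h.symm
    omega

theorem outEdges_chamberBall_nextLayer (o : BourdonGroup p q) (n : ℕ) :
    outEdges (chamberBall o n) (nextLayer o n) = cutEdges (chamberBall o (n + 1)) := by
  ext e
  induction e with
  | _ a b =>
    simp only [mem_outEdges (disjoint_chamberBall_nextLayer o n), mem_cutEdges, mem_nextLayer_iff,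
      mem_chamberBall]
    refine and_congr_right fun h => ?_
    have h1 := height_le_of_adj o h
    have h2 := height_le_of_adj o h.symm
    omega

theorem disjoint_cutEdges_succ (o : BourdonGroup p q) (n : ℕ) :
    Disjoint (cutEdges (chamberBall o n)) (cutEdges (chamberBall o (n + 1))) := by
  rw [Finset.disjoint_left]
  intro e
  induction e with
  | _ a b =>
    simp only [mem_cutEdges, mem_chamberBall]
    rintro ⟨h, h'⟩
    have h1 := height_le_of_adj o h
    have h2 := height_le_of_adj o h.symm
    omega

theorem contractedTensor_glueLayer (T : ∀ g : BourdonGroup p q, (Leg g → Fin d) → ℂ)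
    (o : BourdonGroup p q) (n : ℕ) (x : BourdonGroup p q × Fin (q - 1) → Fin d)
    (c : Sym2 (BourdonGroup p q) → Fin d) {x' : BulkLeg (nextLayer o n) → Fin d}
    {y : OuterLeg (chamberBall o n) → Fin d} {y' : OuterLeg (chamberBall o (n + 1)) → Fin d}
    (hx : ∀ k, x' k = x (k.1.1, k.2)) (hy : ∀ e, y e = c s(e.1.1, e.1.2))
    (hy' : ∀ e, y' e = c s(e.1.1, e.1.2)) :
    contractedTensor T (nextLayer o n) x' (glueLayer o n y y') = amplitude T (nextLayer o n) x c :=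
  contractedTensor_eq_amplitude T _ x c hx fun e => by
    unfold glueLayer
    split_ifs
    · rw [hy, Sym2.eq_swap]
    · rw [hy']

/-- Values on the bulk legs of a ball amount to values on those of the next layer and values on
those of the smaller ball. -/
noncomputable def bulkSplit (d : ℕ) (o : BourdonGroup p q) (n : ℕ) :
    (BulkLeg (chamberBall o (n + 1)) → Fin d) ≃
      (BulkLeg (nextLayer o n) → Fin d) × (BulkLeg (chamberBall o n) → Fin d) where
  toFun x := (fun k => x (⟨k.1.1, nextLayer_subset o n k.1.2⟩, k.2),
    fun k => x (⟨k.1.1, chamberBall_subset_succ o n k.1.2⟩, k.2))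
  invFun x k := if h : k.1.1 ∈ chamberBall o n then x.2 (⟨k.1.1, h⟩, k.2)
    else x.1 (⟨k.1.1, mem_nextLayer.mpr ⟨k.1.2, h⟩⟩, k.2)
  left_inv x := by
    funext k
    dsimp only
    split_ifs <;> rfl
  right_inv x := by
    refine Prod.ext (funext fun k => ?_) (funext fun k => ?_)
    · exact dif_neg (mem_nextLayer.mp k.1.2).2
    · exact dif_pos k.1.2

/-- The ball of radius `n + 1` is contracted by contracting the smaller ball and the next layer, and
then the boundary legs of the smaller ball. -/
theorem contractedTensor_succ (T : ∀ g : BourdonGroup p q, (Leg g → Fin d) → ℂ) (i : Fin d)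
    (o : BourdonGroup p q) (n : ℕ) (x : BulkLeg (chamberBall o (n + 1)) → Fin d)
    (y' : OuterLeg (chamberBall o (n + 1)) → Fin d) :
    contractedTensor T (chamberBall o (n + 1)) x y' =
      ∑ y, contractedTensor T (chamberBall o n) (bulkSplit d o n x).2 y *
        contractedTensor T (nextLayer o n) (bulkSplit d o n x).1 (glueLayer o n y y') := by
  have hx := extendBulk_apply i x
  have hsplit := amplitude_union T (disjoint_chamberBall_nextLayer o n) (extendBulk i x)
    (extendCut i y')
  rw [chamberBall_union_nextLayer, crossEdges_chamberBall_nextLayer] at hsplit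
  rw [contractedTensor_eq_amplitude T _ (extendBulk i x) (extendCut i y') (fun k => (hx k).symm)
    fun e => (extendCut_apply i y' e).symm, hsplit, sum_outerLeg_eq_sum_cutEdges]
  refine Finset.sum_congr rfl fun w _ => ?_
  have hw : ∀ e : OuterLeg (chamberBall o n), w (outerLegEquiv _ e) =
      updateFinset (extendCut i y') _ w s(e.1.1, e.1.2) :=
    fun e => (updateFinset_outerLeg _ w e).symm
  rw [contractedTensor_eq_amplitude T (chamberBall o n) (extendBulk i x)
      (updateFinset (extendCut i y') _ w) (x' := (bulkSplit d o n x).2)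
      (fun k => (hx (⟨k.1.1, chamberBall_subset_succ o n k.1.2⟩, k.2)).symm) hw,
    contractedTensor_glueLayer T o n (extendBulk i x) (updateFinset (extendCut i y') _ w)
      (x' := (bulkSplit d o n x).1)
      (fun k => (hx (⟨k.1.1, nextLayer_subset o n k.1.2⟩, k.2)).symm) hw]
  intro e
  have he : s(e.1.1, e.1.2) ∉ cutEdges (chamberBall o n) := fun h =>
    Finset.disjoint_left.mp (disjoint_cutEdges_succ o n) h (outerLegEquiv _ e).2
  rw [updateFinset_of_notMem _ _ he, extendCut_apply]

/-- The identity `M N = N j`, which holds exactly, without scaling factors. -/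
theorem layerMap_networkMap (T : ∀ g : BourdonGroup p q, (Leg g → Fin d) → ℂ) (i : Fin d)
    (ref : EuclideanSpace ℂ (Fin d)) (o : BourdonGroup p q) (n : ℕ) (ψ : CodeSpace d o n) :
    layerMap T ref o n (networkMap T o n ψ) = networkMap T o (n + 1) (tensorRef ref o n ψ) := by
  ext y'
  let G : (BulkLeg (nextLayer o n) → Fin d) × (BulkLeg (chamberBall o n) → Fin d) → ℂ :=
    fun x => ∑ y, contractedTensor T (chamberBall o n) x.2 y *
      contractedTensor T (nextLayer o n) x.1 (glueLayer o n y y') * (ψ x.2 * ∏ k, ref (x.1 k))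
  have h : ∀ x, contractedTensor T (chamberBall o (n + 1)) x y' * tensorRef ref o n ψ x =
      G (bulkSplit d o n x) := fun x => by
    rw [contractedTensor_succ T i, Finset.sum_mul]
    rfl
  change ∑ y, (∑ x, contractedTensor T (nextLayer o n) x (glueLayer o n y y') * ∏ k, ref (x k)) *
    (∑ x, contractedTensor T (chamberBall o n) x y * ψ x) =
    ∑ x, contractedTensor T (chamberBall o (n + 1)) x y' * tensorRef ref o n ψ x
  rw [Finset.sum_congr rfl fun x _ => h x, Equiv.sum_comp (bulkSplit d o n) G, Finset.sum_comm]
  refine Finset.sum_congr rfl fun y _ => ?_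
  rw [Finset.sum_mul_sum, ← Fintype.sum_prod_type']
  exact Finset.sum_congr rfl fun x _ => by ring

/-- Tensoring with copies of a unit vector preserves the norm. -/
theorem norm_tensor_ref {K Y : Type*} [Fintype K] [DecidableEq K] [Fintype Y]
    {ref : EuclideanSpace ℂ (Fin d)} (href : ‖ref‖ = 1) (φ : EuclideanSpace ℂ Y) :
    ‖(WithLp.toLp 2 fun a => φ a.2 * ∏ k, ref (a.1 k) : EuclideanSpace ℂ ((K → Fin d) × Y))‖ =
      ‖φ‖ := by
  have h1 : ∑ x : K → Fin d, ∏ k, ‖ref (x k)‖ ^ 2 = 1 := by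
    have h2 : ∑ i, ‖ref i‖ ^ 2 = 1 := by
      rw [← EuclideanSpace.norm_sq_eq, href, one_pow]
    have h3 := Finset.prod_univ_sum (fun _ : K => (Finset.univ : Finset (Fin d)))
      fun _ i => ‖ref i‖ ^ 2
    rw [Fintype.piFinset_univ] at h3
    rw [← h3, h2, Finset.prod_const_one]
  rw [← sq_eq_sq₀ (norm_nonneg _) (norm_nonneg _), EuclideanSpace.norm_sq_eq,
    EuclideanSpace.norm_sq_eq, Fintype.sum_prod_type_right]
  refine Finset.sum_congr rfl fun y _ => ?_
  simp only [norm_mul, norm_prod, mul_pow, ← Finset.prod_pow]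
  rw [← Finset.mul_sum, h1, mul_one]

theorem norm_tensorRef {ref : EuclideanSpace ℂ (Fin d)} (href : ‖ref‖ = 1) (o : BourdonGroup p q)
    (n : ℕ) (ψ : CodeSpace d o n) : ‖tensorRef ref o n ψ‖ = ‖ψ‖ := by
  classical
  rw [← norm_tensor_ref (K := BulkLeg (nextLayer o n)) href ψ,
    ← sq_eq_sq₀ (norm_nonneg _) (norm_nonneg _), EuclideanSpace.norm_sq_eq,
    EuclideanSpace.norm_sq_eq]
  exact Fintype.sum_equiv (bulkSplit d o n) _ _ fun x => rfl

theorem exists_norm_sq_layerMap (hp : 5 ≤ p) (i : Fin d)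
    {T : ∀ g : BourdonGroup p q, (Leg g → Fin d) → ℂ}
    (hT : ∀ g, IsPerfectTensor (T g)) {ref : EuclideanSpace ℂ (Fin d)} (href : ‖ref‖ = 1)
    (o : BourdonGroup p q) (n : ℕ) :
    ∃ C : ℝ, 0 < C ∧ ∀ φ, ‖layerMap T ref o n φ‖ ^ 2 = C * ‖φ‖ ^ 2 := by
  classical
  obtain ⟨C, hC, h⟩ := exists_gram_amplitude hp hT o (chamberBall o n) (nextLayer o n)
    (disjoint_chamberBall_nextLayer o n) fun g hg h hh => by
      rw [mem_nextLayer_iff] at hg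
      rw [mem_chamberBall] at hh
      omega
  rw [outEdges_chamberBall_nextLayer, crossEdges_chamberBall_nextLayer] at h
  refine ⟨C, hC, fun φ => ?_⟩
  let K : (BulkLeg (nextLayer o n) → Fin d) × (OuterLeg (chamberBall o n) → Fin d) →
      (OuterLeg (chamberBall o (n + 1)) → Fin d) → ℂ :=
    fun a y' => contractedTensor T (nextLayer o n) a.1 (glueLayer o n a.2 y')
  have hK : layerMap T ref o n φ =
      kernelMap K (WithLp.toLp 2 fun a => φ a.2 * ∏ k, ref (a.1 k)) := by
    ext y'
    change ∑ y, (∑ x, contractedTensor T (nextLayer o n) x (glueLayer o n y y') *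
      ∏ k, ref (x k)) * φ y = ∑ a, K a y' * (φ a.2 * ∏ k, ref (a.1 k))
    rw [Fintype.sum_prod_type_right]
    refine Finset.sum_congr rfl fun y _ => ?_
    rw [Finset.sum_mul]
    exact Finset.sum_congr rfl fun x _ => by ring
  rw [hK, norm_sq_kernelMap_of_gram K C, norm_tensor_ref href]
  have hKa : ∀ a w, K a (fun e => w (outerLegEquiv _ e)) = amplitude T (nextLayer o n)
      (extendBulk i a.1) (updateFinset (extendCut i a.2) _ w) := fun a w =>
    contractedTensor_glueLayer T o n _ _ (fun k => (extendBulk_apply i a.1 k).symm)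
      (fun e => by
        have he : s(e.1.1, e.1.2) ∉ cutEdges (chamberBall o (n + 1)) :=
          Finset.disjoint_left.mp (disjoint_cutEdges_succ o n) (outerLegEquiv _ e).2
        rw [updateFinset_of_notMem _ _ he, extendCut_apply])
      fun e => (updateFinset_outerLeg _ w e).symm
  rintro ⟨x, y⟩ ⟨x', y'⟩
  rw [sum_outerLeg_eq_sum_cutEdges]
  simp only [hKa, h]
  refine if_congr ?_ rfl rfl
  rw [extendBulk_agree_iff, Prod.mk.injEq]
  refine and_congr_right fun _ => ⟨fun hyy => funext fun e => ?_, fun hyy e _ => by rw [hyy]⟩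
  rw [← extendCut_apply i y, ← extendCut_apply i y']
  exact hyy _ (outerLegEquiv _ e).2

end Layers

/-! ### The isometries and their limits -/

section Isometries

/-- A linear map that multiplies all norms by `√C`, rescaled to a linear isometry. -/
noncomputable def isometryOfNormSq {E F : Type*} [NormedAddCommGroup E] [NormedSpace ℂ E]
    [NormedAddCommGroup F] [NormedSpace ℂ F] (f : E →ₗ[ℂ] F) {C : ℝ} (hC : 0 < C)
    (h : ∀ v, ‖f v‖ ^ 2 = C * ‖v‖ ^ 2) : E →ₗᵢ[ℂ] F where
  toLinearMap := (((√C)⁻¹ : ℝ) : ℂ) • f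
  norm_map' v := by
    rw [← sq_eq_sq₀ (norm_nonneg _) (norm_nonneg _), LinearMap.smul_apply, norm_smul, mul_pow, h,
      Complex.norm_real, norm_inv, inv_pow, Real.norm_eq_abs, sq_abs, Real.sq_sqrt hC.le,
      inv_mul_cancel_left₀ hC.ne']

variable {p q : ℕ} [NeZero p] [NeZero q] {d : ℕ}

/-- The bulk-to-boundary map as a linear map. -/
noncomputable def networkLinearMap (T : ∀ g : BourdonGroup p q, (Leg g → Fin d) → ℂ)
    (o : BourdonGroup p q) (n : ℕ) : CodeSpace d o n →ₗ[ℂ] PhysSpace d o n :=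
  kernelMap fun x y => contractedTensor T (chamberBall o n) x y

/-- The boundary-to-boundary map as a linear map. -/
noncomputable def layerLinearMap (T : ∀ g : BourdonGroup p q, (Leg g → Fin d) → ℂ)
    (ref : EuclideanSpace ℂ (Fin d)) (o : BourdonGroup p q) (n : ℕ) :
    PhysSpace d o n →ₗ[ℂ] PhysSpace d o (n + 1) :=
  kernelMap fun y y' => ∑ x, contractedTensor T (nextLayer o n) x (glueLayer o n y y') *
    ∏ k, ref (x k)

/-- Tensoring with the unit vector `ref` on the bulk legs of the next layer, as an isometry. -/
noncomputable def tensorRefIsometry {ref : EuclideanSpace ℂ (Fin d)} (href : ‖ref‖ = 1)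
    (o : BourdonGroup p q) (n : ℕ) : CodeSpace d o n →ₗᵢ[ℂ] CodeSpace d o (n + 1) where
  toFun := tensorRef ref o n
  map_add' ψ φ := by
    ext x
    exact add_mul _ _ _
  map_smul' r ψ := by
    ext x
    exact mul_assoc _ _ _
  norm_map' := norm_tensorRef href o n

theorem exists_lt_finrank_codeSpace (hp : 5 ≤ p) (hq : 2 ≤ q) (hd : 2 ≤ d)
    (o : BourdonGroup p q) (N : ℕ) : N < Module.finrank ℂ (CodeSpace d o N) := by
  rw [finrank_euclideanSpace, Fintype.card_fun, Fintype.card_fin, Fintype.card_prod,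
    Fintype.card_coe, Fintype.card_fin]
  calc N < (chamberBall o N).card := lt_card_chamberBall hp hq o N
    _ ≤ (chamberBall o N).card * (q - 1) := Nat.le_mul_of_pos_right _ (by omega)
    _ ≤ d ^ ((chamberBall o N).card * (q - 1)) := (Nat.lt_pow_self hd).le

end Isometries

theorem mainTheorem9 (p q d : ℕ) [NeZero p] [NeZero q] (hp : 5 ≤ p) (hpodd : Odd p)
    (hq : 2 ≤ q) (hd : 2 ≤ d)
    (T : ∀ g : BourdonGroup p q, (Leg g → Fin d) → ℂ) (hT : ∀ g, IsPerfectTensor (T g))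
    (o : BourdonGroup p q) (ref : EuclideanSpace ℂ (Fin d)) (href : ‖ref‖ = 1) :
    ∃ (jcode : ∀ n, CodeSpace d o n →ₗᵢ[ℂ] CodeSpace d o (n + 1))
      (jphys : ∀ n, PhysSpace d o n →ₗᵢ[ℂ] PhysSpace d o (n + 1))
      (U : ∀ n, CodeSpace d o n →ₗᵢ[ℂ] PhysSpace d o n),
      (∀ n ψ, jcode n ψ = tensorRef ref o n ψ) ∧
      (∀ n, ∃ b : ℝ, 0 < b ∧ ∀ φ, jphys n φ = (b : ℂ) • layerMap T ref o n φ) ∧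
      (∀ n, ∃ a : ℝ, 0 < a ∧ ∀ ψ, U n ψ = (a : ℂ) • networkMap T o n ψ) ∧
      (∀ n ψ, U (n + 1) (jcode n ψ) = jphys n (U n ψ)) ∧
      IsHilbertDirectLimit.{0, w} jcode (hilbertLimitOf jcode) ∧
      IsHilbertDirectLimit.{0, w} jphys (hilbertLimitOf jphys) ∧
      ¬ FiniteDimensional ℂ (HilbertLimit jcode) ∧
      ¬ FiniteDimensional ℂ (HilbertLimit jphys) ∧
      ∃! u : HilbertLimit jcode →ₗᵢ[ℂ] HilbertLimit jphys,
        ∀ n ψ, u (hilbertLimitOf jcode n ψ) = hilbertLimitOf jphys n (U n ψ) := by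
  let i : Fin d := ⟨0, by omega⟩
  choose C hC hnet using exists_norm_sq_networkMap hp i hT o
  choose B hB hlayer using exists_norm_sq_layerMap hp i hT href o
  -- Evaluation of both sides of `M N = N j` at a nonzero vector relates the scaling factors.
  have hBC : ∀ n, C (n + 1) = B n * C n := by
    intro n
    have : Nonempty (BulkLeg (chamberBall o n) → Fin d) := ⟨fun _ => i⟩
    obtain ⟨ψ, hψ⟩ := exists_ne (0 : CodeSpace d o n)
    have h1 := hnet (n + 1) (tensorRef ref o n ψ)
    rw [← layerMap_networkMap T i, hlayer, hnet, norm_tensorRef href, ← mul_assoc] at h1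
    exact (mul_right_cancel₀ (pow_ne_zero 2 (norm_ne_zero_iff.mpr hψ)) h1).symm
  let jphys := fun n => isometryOfNormSq (layerLinearMap T ref o n) (hB n) (hlayer n)
  let U := fun n => isometryOfNormSq (networkLinearMap T o n) (hC n) (hnet n)
  have hcomm : ∀ n ψ, U (n + 1) (tensorRefIsometry href o n ψ) = jphys n (U n ψ) := by
    intro n ψ
    have h1 : U (n + 1) (tensorRefIsometry href o n ψ) =
        (((√(C (n + 1)))⁻¹ : ℝ) : ℂ) • networkMap T o (n + 1) (tensorRef ref o n ψ) := rfl
    have h2 : jphys n (U n ψ) = (((√(B n))⁻¹ : ℝ) : ℂ) •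
        layerLinearMap T ref o n ((((√(C n))⁻¹ : ℝ) : ℂ) • networkMap T o n ψ) := rfl
    have h3 : layerLinearMap T ref o n (networkMap T o n ψ) =
        networkMap T o (n + 1) (tensorRef ref o n ψ) := layerMap_networkMap T i ref o n ψ
    rw [h1, h2, map_smul, h3, smul_smul, hBC, Real.sqrt_mul (hB n).le, mul_inv, Complex.ofReal_mul]
  refine ⟨tensorRefIsometry href o, jphys, U, fun _ _ => rfl,
    fun n => ⟨_, inv_pos.mpr (Real.sqrt_pos.mpr (hB n)), fun _ => rfl⟩,
    fun n => ⟨_, inv_pos.mpr (Real.sqrt_pos.mpr (hC n)), fun _ => rfl⟩, hcomm,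
    isHilbertDirectLimit_hilbertLimitOf _, isHilbertDirectLimit_hilbertLimitOf _,
    not_finiteDimensional_hilbertLimit _ fun N => ⟨N, exists_lt_finrank_codeSpace hp hq hd o N⟩,
    not_finiteDimensional_hilbertLimit _ fun N => ⟨N, ?_⟩,
    existsUnique_hilbertLimit_map _ _ U hcomm⟩
  exact (exists_lt_finrank_codeSpace hp hq hd o N).trans_le
    (LinearMap.finrank_le_finrank_of_injective (f := (U N).toLinearMap) (U N).injective)
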